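/- \textbf{Setting.} Let $H$ be a complex Hilbert space with inner product $\langle\cdot,\cdot\rangle$, linear in the first variable. For $\theta\in[0,\pi/2)$ let $\Sigma_\theta:=\{re^{i\alpha} : r>0,\ \alpha\in(-\theta,\theta)\cup\{0\}\}$. A form $(a,j)$ in $H$ consists of a sesquilinear form $a$ on a complex vector space $\operatorname{dom}(a)$ and a linear map $j\colon\operatorname{dom}(a)\to H$; write $a(u):=a(u,u)$. It is quasi-sectorial with vertex $\gamma\in\mathbb R$ if there is $\theta'\in[0,\pi/2)$ with $a(u)-\gamma\|j(u)\|^2\in\overline{\Sigma_{\theta'}}$ for all $u\in\operatorname{dom}(a)$. In this case $\operatorname{dom}(a)$ carries the semi-inner product $$\langle x,y\rangle_{a,j}:=\tfrac12\bigl(a(x,y)+\overline{a(y,x)}\bigr)+(1-\gamma)\langle j(x),j(y)\rangle .$$ Let $V$ be the completion of $(\operatorname{dom}(a),\langle\cdot,\cdot\rangle_{a,j})$, and let $\tilde\jmath\colon V\to H$ and $\tilde a\colon V\times V\to\mathbb C$ be the continuous extensions of $j$ and $a$. The linear relation associated with $(a,j)$ is $$A:=\{(x,y)\in H\times H : \exists\,u\in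 V\colon\ \tilde\jmath(u)=x,\ \ \tilde a(u,v)=\langle y,\tilde\jmath(v)\rangle\ (v\in V)\}.$$ A core for $a$ is a subspace of $\operatorname{dom}(a)$ that is dense with respect to $\langle\cdot,\cdot\rangle_{a,j}$. A degenerate strongly continuous semigroup on $H$ is a map $T\colon[0,\infty)\to\mathcal L(H)$ with $T(s+t)=T(s)T(t)$ for all $s,t\ge0$ and $T(t)x\to T(0)x$ as $t\to0+$ for all $x\in H$. Then $T(0)$ is a projection. Its generator is the linear relation $\{(x,A_1x+y) : x\in\operatorname{dom}(A_1),\ y\in\ker T(0)\}$, where $A_1$ is the generator of the $C_0$-semigroup obtained by restricting $T$ to $\operatorname{ran}T(0)$. \textbf{Theorem.} Let $(a,j)$ be a quasi-sectorial form in $H$ with vertex $\gamma$. For $n\in\mathbb N$ let $a_n$ be a sesquilinear form on a subspace $\operatorname{dom}(a_n)\subseteq\operatorname{dom}(a)$. Let $\theta\in[0,\frac\pi2)$, and assume that $$a_n(u)-a(u)\in\overline{\Sigma_\theta}\qquad(u\in\operatorname{dom}(a_n),\ n\in\mathbb N).$$ Let $D$ be a core for $a$, and suppose that for all $u\in D$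 there exists a sequence $(u_n)$ with $u_n\in\operatorname{dom}(a_n)$ for all $n\in\mathbb N$, such that $u_n\to u$ in $\operatorname{dom}(a)$ and $a_n(u_n)-a(u_n)\to0$ as $n\to\infty$. Let $A$ be the linear relation associated with $(a,j)$, and let $A_n$ be the linear relation associated with $(a_n,j|_{\operatorname{dom}(a_n)})$ (which is again quasi-sectorial with vertex $\gamma$), for $n\in\mathbb N$. Then $-A$ is the generator of a unique degenerate strongly continuous semigroup $T$ on $H$, for each $n\in\mathbb N$ the relation $-A_n$ is the generator of a unique degenerate strongly continuous semigroup $T_n$ on $H$, and for all $x\in H$ $$T_n(t)x\to T(t)x\qquad(n\to\infty)$$ uniformly for $t$ in compact subsets of $[0,\infty)$. -/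

import Mathlib

open Filter Topology
open scoped NNReal ComplexConjugate

noncomputable section

/-! ### Sectors -/

/-- `sectorSet θ = {r e^{iα} | r > 0, α ∈ (-θ, θ) ∪ {0}}`. -/
def sectorSet (θ : ℝ) : Set ℂ :=
  {z | ∃ r α : ℝ, 0 < r ∧ (α ∈ Set.Ioo (-θ) θ ∨ α = 0) ∧
    z = (r : ℂ) * Complex.exp ((α : ℂ) * Complex.I)}

theorem mem_closure_sectorSet_iff {θ : ℝ} (hθ : θ ∈ Set.Ico 0 (Real.pi / 2)) (z : ℂ) :
    z ∈ closure (sectorSet θ) ↔ ‖z‖ * Real.cos θ ≤ z.re := by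
  obtain ⟨h0, h1⟩ := hθ
  constructor
  · intro hz
    have hcl : IsClosed {z : ℂ | ‖z‖ * Real.cos θ ≤ z.re} :=
      isClosed_le (by fun_prop) Complex.continuous_re
    refine closure_minimal ?_ hcl hz
    rintro w ⟨r, α, hr, hα, rfl⟩
    have hcos : Real.cos θ ≤ Real.cos α := by
      rw [← Real.cos_abs α]
      apply Real.cos_le_cos_of_nonneg_of_le_pi (abs_nonneg _) (by linarith [Real.pi_pos])
      rcases hα with hα | rfl
      · exact (abs_lt.2 hα).le
      · simpa using h0
    simp only [Set.mem_ofPred_eq, norm_mul, Complex.norm_real, Complex.norm_exp_ofReal_mul_I,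
      mul_one, Complex.re_ofReal_mul, Complex.exp_ofReal_mul_I_re, Real.norm_eq_abs,
      abs_of_pos hr]
    exact mul_le_mul_of_nonneg_left hcos hr.le
  · intro hz
    have key : ∀ (r β : ℝ), 0 < r → |β| ≤ θ →
        (r : ℂ) * Complex.exp ((β : ℂ) * Complex.I) ∈ closure (sectorSet θ) := by
      intro r β hr hβ
      have hc : Continuous fun s : ℝ =>
          (r : ℂ) * Complex.exp (((s * β : ℝ) : ℂ) * Complex.I) := by fun_prop
      have ht := hc.tendsto 1
      rw [one_mul] at ht
      have : (𝓝[Set.Ioo 0 1] (1 : ℝ)).NeBot := right_nhdsWithin_Ioo_neBot zero_lt_one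
      refine mem_closure_of_tendsto (ht.mono_left (nhdsWithin_le_nhds (s := Set.Ioo 0 1))) ?_
      · filter_upwards [self_mem_nhdsWithin] with s hs
        refine ⟨r, s * β, hr, ?_, rfl⟩
        by_cases hb : β = 0
        · right; simp [hb]
        · left
          rw [Set.mem_Ioo, ← abs_lt, abs_mul, abs_of_pos hs.1]
          have := abs_pos.2 hb
          nlinarith [hs.2]
    by_cases hz0 : z = 0
    · subst hz0
      have ht : Tendsto (fun r : ℝ => (r : ℂ) * Complex.exp (((0 : ℝ) : ℂ) * Complex.I))
          (𝓝[>] 0) (𝓝 0) := by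
        have hc : Continuous fun r : ℝ =>
          (r : ℂ) * Complex.exp (((0 : ℝ) : ℂ) * Complex.I) := by fun_prop
        have := hc.tendsto 0
        simp only [Complex.ofReal_zero, zero_mul] at this ⊢
        exact this.mono_left nhdsWithin_le_nhds
      refine mem_closure_of_tendsto ht ?_
      filter_upwards [self_mem_nhdsWithin] with r hr
      exact ⟨r, 0, hr, Or.inr rfl, rfl⟩
    · rw [← Complex.norm_mul_exp_arg_mul_I z]
      refine key _ _ (norm_pos_iff.2 hz0) ?_
      have hn := norm_pos_iff.2 hz0
      have hcos : Real.cos θ ≤ Real.cos |z.arg| := by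
        rw [Real.cos_abs, Complex.cos_arg hz0, le_div_iff₀ hn]
        linarith
      by_contra hlt
      push Not at hlt
      exact absurd hcos (not_le.2 (Real.cos_lt_cos_of_nonneg_of_le_pi h0
        (Complex.abs_arg_le_pi z) hlt))

/-- If `z` and `w` lie in closed sectors, then `z + w` lies in the larger of the two sectors. -/
theorem add_mem_closure_sectorSet {θ₁ θ₂ : ℝ} (h₁ : θ₁ ∈ Set.Ico 0 (Real.pi / 2))
    (h₂ : θ₂ ∈ Set.Ico 0 (Real.pi / 2)) {z w : ℂ} (hz : z ∈ closure (sectorSet θ₁))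
    (hw : w ∈ closure (sectorSet θ₂)) : z + w ∈ closure (sectorSet (max θ₁ θ₂)) := by
  have hm : max θ₁ θ₂ ∈ Set.Ico 0 (Real.pi / 2) := ⟨le_max_of_le_left h₁.1, max_lt h₁.2 h₂.2⟩
  rw [mem_closure_sectorSet_iff h₁] at hz
  rw [mem_closure_sectorSet_iff h₂] at hw
  rw [mem_closure_sectorSet_iff hm]
  have c1 : Real.cos (max θ₁ θ₂) ≤ Real.cos θ₁ :=
    Real.cos_le_cos_of_nonneg_of_le_pi h₁.1 (by linarith [hm.2, Real.pi_pos]) (le_max_left _ _)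
  have c2 : Real.cos (max θ₁ θ₂) ≤ Real.cos θ₂ :=
    Real.cos_le_cos_of_nonneg_of_le_pi h₂.1 (by linarith [hm.2, Real.pi_pos]) (le_max_right _ _)
  have c0 : 0 ≤ Real.cos (max θ₁ θ₂) :=
    Real.cos_nonneg_of_mem_Icc ⟨by linarith [hm.1, Real.pi_pos], hm.2.le⟩
  calc ‖z + w‖ * Real.cos (max θ₁ θ₂) ≤ (‖z‖ + ‖w‖) * Real.cos (max θ₁ θ₂) :=
        mul_le_mul_of_nonneg_right (norm_add_le _ _) c0
    _ = ‖z‖ * Real.cos (max θ₁ θ₂) + ‖w‖ * Real.cos (max θ₁ θ₂) := by ring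
    _ ≤ ‖z‖ * Real.cos θ₁ + ‖w‖ * Real.cos θ₂ := by gcongr
    _ ≤ (z + w).re := by rw [Complex.add_re]; linarith

/-! ### Sesquilinear forms and quasi-sectorial forms in a Hilbert space -/

/-- Sesquilinear forms on `E`: linear in the first and antilinear in the second variable. -/
abbrev SesqForm (E : Type*) [AddCommGroup E] [Module ℂ E] : Type _ := E →ₗ[ℂ] E →ₗ⋆[ℂ] ℂ

section Forms

variable {H : Type*} [NormedAddCommGroup H] [InnerProductSpace ℂ H]
variable {E : Type*} [AddCommGroup E] [Module ℂ E]

/-- The form `(a, j)` in `H` is quasi-sectorial of angle `θ` and with vertex `γ`, that is,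
`a(u) - γ ‖j u‖² ∈ closure Σ_θ` for all `u`. -/
def IsQuasiSectorialWith (a : SesqForm E) (j : E →ₗ[ℂ] H) (θ γ : ℝ) : Prop :=
  ∀ u : E, a u u - ((γ * ‖j u‖ ^ 2 : ℝ) : ℂ) ∈ closure (sectorSet θ)

/-- The form `(a, j)` in `H` is quasi-sectorial with vertex `γ` (of some angle
`θ ∈ [0, π/2)`). -/
def IsQuasiSectorial (a : SesqForm E) (j : E →ₗ[ℂ] H) (γ : ℝ) : Prop :=
  ∃ θ ∈ Set.Ico 0 (Real.pi / 2), IsQuasiSectorialWith a j θ γ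

/-- A form on a subspace `D` of the domain of a quasi-sectorial form `(a, j)`, whose difference
to `a` has values in a closed sector, is quasi-sectorial with the same vertex. -/
theorem IsQuasiSectorial.of_sub_mem {a : SesqForm E} {j : E →ₗ[ℂ] H} {γ : ℝ}
    (h : IsQuasiSectorial a j γ) {D : Submodule ℂ E} {b : SesqForm D} {θ : ℝ}
    (hθ : θ ∈ Set.Ico 0 (Real.pi / 2))
    (hb : ∀ u : D, b u u - a u u ∈ closure (sectorSet θ)) :
    IsQuasiSectorial b (j ∘ₗ D.subtype) γ := by
  obtain ⟨θ', hθ', h'⟩ := h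
  refine ⟨max θ' θ, ⟨le_max_of_le_left hθ'.1, max_lt hθ'.2 hθ.2⟩, fun u => ?_⟩
  have := add_mem_closure_sectorSet hθ' hθ (h' u) (hb u)
  convert this using 1
  simp only [LinearMap.comp_apply, Submodule.subtype_apply]
  ring

theorem IsQuasiSectorial.re_nonneg {a : SesqForm E} {j : E →ₗ[ℂ] H} {γ : ℝ}
    (h : IsQuasiSectorial a j γ) (u : E) : 0 ≤ (a u u).re - γ * ‖j u‖ ^ 2 := by
  obtain ⟨θ, hθ, h'⟩ := h
  have := (mem_closure_sectorSet_iff hθ _).1 (h' u)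
  rw [Complex.sub_re, Complex.ofReal_re] at this
  have c0 : 0 ≤ Real.cos θ :=
    Real.cos_nonneg_of_mem_Icc ⟨by linarith [hθ.1, Real.pi_pos], hθ.2.le⟩
  exact (mul_nonneg (norm_nonneg _) c0).trans this

/-- The vector space `dom(a) = E`, as a type of its own that will carry the semi-inner product
`⟨x, y⟩_{a,j} = (Re a)(x, y) + (1 - γ) ⟨j x, j y⟩`. -/
def FormDomain {a : SesqForm E} {j : E →ₗ[ℂ] H} {γ : ℝ} (_h : IsQuasiSectorial a j γ) : Type _ := E

namespace FormDomain

variable {a : SesqForm E} {j : E →ₗ[ℂ] H} {γ : ℝ} (h : IsQuasiSectorial a j γ)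

instance : AddCommGroup (FormDomain h) := inferInstanceAs (AddCommGroup E)

instance : Module ℂ (FormDomain h) := inferInstanceAs (Module ℂ E)

/-- The identity map from `E` to `dom(a)`. -/
def of : E ≃ₗ[ℂ] FormDomain h := LinearEquiv.refl ℂ E

/-- The map `j` on `dom(a)`. -/
def jLin : FormDomain h →ₗ[ℂ] H := j

/-- The form `a` on `dom(a)`. -/
def aLin : FormDomain h →ₗ[ℂ] FormDomain h →ₗ⋆[ℂ] ℂ := a

/-- The semi-inner product `⟨x, y⟩_{a,j} = (Re a)(x, y) + (1 - γ) ⟨j x, j y⟩`, where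
`(Re a)(x, y) = (a(x, y) + conj a(y, x)) / 2`. Mathlib's inner products are antilinear in the
first variable, hence `inner ℂ y x` is `⟨x, y⟩_{a,j}`. -/
@[reducible]
def core : PreInnerProductSpace.Core ℂ (FormDomain h) where
  inner y x := (aLin h x y + conj (aLin h y x)) / 2
    + ((1 - γ : ℝ) : ℂ) * inner ℂ (jLin h y) (jLin h x)
  conj_inner_symm x y := by
    simp only [map_add, map_mul, map_div₀, Complex.conj_conj, Complex.conj_ofReal,
      inner_conj_symm, Complex.conj_ofNat]
    ring
  re_inner_nonneg x := by
    have h1 := h.re_nonneg x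
    have h2 : ((aLin h x x + conj (aLin h x x)) / 2
        + ((1 - γ : ℝ) : ℂ) * inner ℂ (jLin h x) (jLin h x)).re
        = ((aLin h x x).re - γ * ‖jLin h x‖ ^ 2) + ‖jLin h x‖ ^ 2 := by
      rw [Complex.add_conj, inner_self_eq_norm_sq_to_K]
      simp [← Complex.ofReal_pow]
      ring
    rw [RCLike.re_eq_complex_re, h2]
    exact add_nonneg h1 (sq_nonneg _)
  add_left x y z := by
    simp only [map_add, LinearMap.add_apply, inner_add_left]
    ring
  smul_left x y r := by
    simp only [map_smul, LinearMap.smul_apply, map_smulₛₗ, inner_smul_left, smul_eq_mul, map_mul]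
    ring

instance : SeminormedAddCommGroup (FormDomain h) :=
  @InnerProductSpace.Core.toSeminormedAddCommGroup ℂ (FormDomain h) _ _ _ (core h)

instance : InnerProductSpace ℂ (FormDomain h) := InnerProductSpace.ofCore (core h)

theorem inner_def (x y : FormDomain h) :
    inner ℂ y x = (aLin h x y + conj (aLin h y x)) / 2
      + ((1 - γ : ℝ) : ℂ) * inner ℂ (jLin h y) (jLin h x) := rfl

theorem norm_sq_eq (x : FormDomain h) :
    ‖x‖ ^ 2 = (aLin h x x).re + (1 - γ) * ‖jLin h x‖ ^ 2 := by
  rw [← inner_self_eq_norm_sq (𝕜 := ℂ), inner_def, Complex.add_conj, inner_self_eq_norm_sq_to_K]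
  simp [← Complex.ofReal_pow]

theorem norm_jLin_le (x : FormDomain h) : ‖jLin h x‖ ≤ 1 * ‖x‖ := by
  rw [one_mul]
  refine le_of_sq_le_sq ?_ (norm_nonneg _)
  have h1 : 0 ≤ (aLin h x x).re - γ * ‖jLin h x‖ ^ 2 := h.re_nonneg x
  rw [norm_sq_eq]
  linarith

theorem exists_norm_aLin_self_le : ∃ C, 0 ≤ C ∧ ∀ x : FormDomain h, ‖aLin h x x‖ ≤ C * ‖x‖ ^ 2 := by
  obtain ⟨θ, hθ, hs⟩ := id h
  have c0 : 0 < Real.cos θ :=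
    Real.cos_pos_of_mem_Ioo ⟨by linarith [hθ.1, Real.pi_pos], hθ.2⟩
  refine ⟨1 / Real.cos θ + |γ|, by positivity, fun x => ?_⟩
  have h1 := (mem_closure_sectorSet_iff hθ _).1 (hs x)
  change ‖aLin h x x - ((γ * ‖jLin h x‖ ^ 2 : ℝ) : ℂ)‖ * _
    ≤ (aLin h x x - ((γ * ‖jLin h x‖ ^ 2 : ℝ) : ℂ)).re at h1
  set z := aLin h x x - ((γ * ‖jLin h x‖ ^ 2 : ℝ) : ℂ) with hz
  have hj : ‖jLin h x‖ ^ 2 ≤ ‖x‖ ^ 2 := by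
    have := norm_jLin_le h x
    rw [one_mul] at this
    gcongr
  have hre : z.re ≤ ‖x‖ ^ 2 := by
    rw [norm_sq_eq, hz, Complex.sub_re, Complex.ofReal_re]
    nlinarith [sq_nonneg ‖jLin h x‖]
  have hzn : ‖z‖ ≤ 1 / Real.cos θ * ‖x‖ ^ 2 := by
    rw [one_div_mul_eq_div, le_div_iff₀ c0]
    exact h1.trans hre
  have heq : aLin h x x = z + ((γ * ‖jLin h x‖ ^ 2 : ℝ) : ℂ) := by rw [hz]; ring
  calc ‖aLin h x x‖ ≤ ‖z‖ + ‖((γ * ‖jLin h x‖ ^ 2 : ℝ) : ℂ)‖ := by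
        rw [heq]; exact norm_add_le _ _
    _ = ‖z‖ + |γ| * ‖jLin h x‖ ^ 2 := by
        rw [Complex.norm_real, Real.norm_eq_abs, abs_mul, abs_of_nonneg (sq_nonneg ‖jLin h x‖)]
    _ ≤ 1 / Real.cos θ * ‖x‖ ^ 2 + |γ| * ‖x‖ ^ 2 := by gcongr
    _ = _ := by ring

theorem exists_norm_aLin_le : ∃ C, ∀ x y : FormDomain h, ‖aLin h x y‖ ≤ C * ‖x‖ * ‖y‖ := by
  obtain ⟨C, hC0, hC⟩ := exists_norm_aLin_self_le h
  have pol : ∀ x y : FormDomain h, ‖aLin h x y‖ ≤ C * (‖x‖ ^ 2 + ‖y‖ ^ 2) * 2 := by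
    intro x y
    have e : 4 * aLin h x y = aLin h (x + y) (x + y) - aLin h (x - y) (x - y)
        + Complex.I * aLin h (x + Complex.I • y) (x + Complex.I • y)
        - Complex.I * aLin h (x - Complex.I • y) (x - Complex.I • y) := by
      simp only [map_add, map_sub, map_smul, LinearMap.add_apply, LinearMap.sub_apply,
        LinearMap.smul_apply, map_smulₛₗ, smul_eq_mul, Complex.conj_I]
      linear_combination (2 * aLin h x y - 2 * aLin h y x) * Complex.I_sq
    have p1 := parallelogram_law_with_norm ℂ x y
    have p2 := parallelogram_law_with_norm ℂ x (Complex.I • y)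
    rw [norm_smul, Complex.norm_I, one_mul] at p2
    have n : ‖4 * aLin h x y‖ ≤ ‖aLin h (x + y) (x + y)‖ + ‖aLin h (x - y) (x - y)‖
        + ‖aLin h (x + Complex.I • y) (x + Complex.I • y)‖
        + ‖aLin h (x - Complex.I • y) (x - Complex.I • y)‖ := by
      rw [e]
      refine (norm_sub_le _ _).trans ?_
      rw [norm_mul, Complex.norm_I, one_mul]
      gcongr
      refine (norm_add_le _ _).trans ?_
      rw [norm_mul, Complex.norm_I, one_mul]
      gcongr
      exact norm_sub_le _ _
    rw [norm_mul, Complex.norm_ofNat] at n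
    have q1 := hC (x + y)
    have q2 := hC (x - y)
    have q3 := hC (x + Complex.I • y)
    have q4 := hC (x - Complex.I • y)
    nlinarith [sq_nonneg ‖x‖, sq_nonneg ‖y‖, mul_nonneg hC0 (sq_nonneg ‖x‖),
      mul_nonneg hC0 (sq_nonneg ‖y‖)]
  refine ⟨4 * C, fun x y => ?_⟩
  have main : ∀ ε : ℝ, 0 < ε → ‖aLin h x y‖ ≤ 4 * C * (‖x‖ + ε) * (‖y‖ + ε) := by
    intro ε hε
    have hx : 0 < ‖x‖ + ε := by positivity
    have hy : 0 < ‖y‖ + ε := by positivity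
    have s := pol (((‖x‖ + ε)⁻¹ : ℝ) • x) (((‖y‖ + ε)⁻¹ : ℝ) • y)
    have e : ∀ (r : ℝ) (w : FormDomain h), r • w = (r : ℂ) • w := fun r w => rfl
    rw [e, e] at s
    simp only [map_smul, LinearMap.smul_apply, map_smulₛₗ, smul_eq_mul, norm_mul, norm_smul,
      Complex.norm_real, Complex.conj_ofReal, norm_inv, Real.norm_eq_abs, abs_of_pos hx,
      abs_of_pos hy] at s
    have t1 : ((‖x‖ + ε)⁻¹ * ‖x‖) ^ 2 ≤ 1 := by
      apply pow_le_one₀ (by positivity)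
      rw [inv_mul_le_iff₀ hx]; linarith
    have t2 : ((‖y‖ + ε)⁻¹ * ‖y‖) ^ 2 ≤ 1 := by
      apply pow_le_one₀ (by positivity)
      rw [inv_mul_le_iff₀ hy]; linarith
    have s2 : (‖x‖ + ε)⁻¹ * ((‖y‖ + ε)⁻¹ * ‖aLin h x y‖) ≤ 4 * C := by
      nlinarith
    rw [inv_mul_le_iff₀ hx, inv_mul_le_iff₀ hy] at s2
    linarith
  have hlim : Tendsto (fun ε : ℝ => 4 * C * (‖x‖ + ε) * (‖y‖ + ε)) (𝓝[>] 0)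
      (𝓝 (4 * C * ‖x‖ * ‖y‖)) := by
    have hc : Continuous fun ε : ℝ => 4 * C * (‖x‖ + ε) * (‖y‖ + ε) := by fun_prop
    have := hc.tendsto 0
    simp only [add_zero] at this
    exact this.mono_left nhdsWithin_le_nhds
  refine ge_of_tendsto hlim ?_
  filter_upwards [self_mem_nhdsWithin] with ε hε using main ε hε

/-- `j` as a bounded operator on `dom(a)`. -/
def jCLM : FormDomain h →L[ℂ] H := (jLin h).mkContinuous 1 (norm_jLin_le h)

/-- `a` as a bounded form on `dom(a)`. -/
def aCLM : FormDomain h →L[ℂ] FormDomain h →L⋆[ℂ] ℂ :=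
  (aLin h).mkContinuousOfExistsBound₂ (exists_norm_aLin_le h)

end FormDomain

/-! ### The completion of the form domain and the associated linear relation -/

section Completion

variable {a : SesqForm E} {j : E →ₗ[ℂ] H} {γ : ℝ} (h : IsQuasiSectorial a j γ)

/-- The completion `V` of `(dom(a), ⟨·,·⟩_{a,j})` (a Hilbert space). -/
abbrev FormCompletion : Type _ := UniformSpace.Completion (FormDomain h)

/-- The canonical map `q : dom(a) → V`. -/
def formEmb : FormDomain h →L[ℂ] FormCompletion h := UniformSpace.Completion.toComplL

/-- The continuous extension `j̃ : V → H` of `j`. -/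
def jExt [CompleteSpace H] : FormCompletion h →L[ℂ] H :=
  (FormDomain.jCLM h).extend (formEmb h)

/-- The continuous extension `ã : V × V → ℂ` of `a`. -/
def aExt : FormCompletion h →L[ℂ] FormCompletion h →L⋆[ℂ] ℂ :=
  (((FormDomain.aCLM h).extend (formEmb h)).flip.extend (formEmb h)).flip

theorem denseRange_formEmb : DenseRange (formEmb h) :=
  UniformSpace.Completion.denseRange_coe

theorem isUniformInducing_formEmb : IsUniformInducing (formEmb h) :=
  UniformSpace.Completion.isUniformInducing_coe _

theorem jExt_formEmb [CompleteSpace H] (x : E) :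
    jExt h (formEmb h (FormDomain.of h x)) = j x :=
  ContinuousLinearMap.extend_eq _ (denseRange_formEmb h) (isUniformInducing_formEmb h) _

theorem aExt_formEmb (x y : E) :
    aExt h (formEmb h (FormDomain.of h x)) (formEmb h (FormDomain.of h y)) = a x y := by
  rw [aExt, ContinuousLinearMap.flip_apply,
    ContinuousLinearMap.extend_eq _ (denseRange_formEmb h) (isUniformInducing_formEmb h),
    ContinuousLinearMap.flip_apply,
    ContinuousLinearMap.extend_eq _ (denseRange_formEmb h) (isUniformInducing_formEmb h)]
  rfl

/-- The linear relation in `H` associated with the quasi-sectorial form `(a, j)`: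
`A = {(x, y) | ∃ u ∈ V, j̃ u = x and ã(u, v) = ⟨y, j̃ v⟩ for all v ∈ V}`. -/
def formRel [CompleteSpace H] : Submodule ℂ (H × H) where
  carrier := {p | ∃ u : FormCompletion h, jExt h u = p.1 ∧
    ∀ v : FormCompletion h, aExt h u v = inner ℂ (jExt h v) p.2}
  zero_mem' := ⟨0, by simp, by simp⟩
  add_mem' := by
    rintro p p' ⟨u, hu, hv⟩ ⟨u', hu', hv'⟩
    exact ⟨u + u', by simp [hu, hu'], fun v => by simp [hv, hv']⟩
  smul_mem' := by
    rintro c p ⟨u, hu, hv⟩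
    exact ⟨c • u, by simp [hu], fun v => by simp [hv]⟩

/-- `D` is a core for `a`: a subspace of `dom(a)` that is dense with respect to
`⟨·,·⟩_{a,j}`. -/
def IsFormCore (D : Submodule ℂ E) : Prop :=
  Dense (FormDomain.of h '' (D : Set E))

end Completion

end Forms

/-! ### Degenerate strongly continuous semigroups -/

section Semigroups

variable {X : Type*} [NormedAddCommGroup X] [NormedSpace ℂ X]

/-- Degenerate strongly continuous (one-parameter) semigroups: `T(s + t) = T(s) T(t)`, and
`T(t) → T(0)` strongly as `t → 0+`. The projection `T(0)` need not be the identity. -/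
structure IsDegenerateSemigroup (T : ℝ≥0 → X →L[ℂ] X) : Prop where
  map_add : ∀ s t, T (s + t) = T s ∘L T t
  tendsto_zero : ∀ x, Tendsto (fun t => T t x) (𝓝[>] 0) (𝓝 (T 0 x))

/-- The generator of a degenerate strongly continuous semigroup `T`, with `X₁ = ran T(0)` and
`X₀ = ker T(0)`: it is `{(x, A₁ x + y) | x ∈ dom(A₁), y ∈ X₀}`, where `A₁` is the generator of
the C₀-semigroup on `X₁` obtained by restricting `T`, that is, `x ∈ X₁` belongs to `dom(A₁)`
and `A₁ x = z` if and only if `t⁻¹ (T(t) x - x) → z` as `t → 0+`. -/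
def generatorRel (T : ℝ≥0 → X →L[ℂ] X) : Submodule ℂ (X × X) where
  carrier := {p | p.1 ∈ (T 0).range ∧ ∃ z y : X,
    Tendsto (fun t : ℝ≥0 => (((t : ℝ) : ℂ)⁻¹) • (T t p.1 - p.1)) (𝓝[>] 0) (𝓝 z) ∧
    y ∈ (T 0).ker ∧ p.2 = z + y}
  zero_mem' := ⟨Submodule.zero_mem _, 0, 0, by simp, Submodule.zero_mem _, by simp⟩
  add_mem' := by
    rintro p p' ⟨hp, z, y, hz, hy, e⟩ ⟨hp', z', y', hz', hy', e'⟩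
    refine ⟨Submodule.add_mem _ hp hp', z + z', y + y', ?_, Submodule.add_mem _ hy hy', ?_⟩
    · refine (hz.add hz').congr fun t => ?_
      simp only [Prod.fst_add, map_add, ← smul_add]
      congr 1
      abel
    · rw [Prod.snd_add, e, e']
      abel
  smul_mem' := by
    rintro c p ⟨hp, z, y, hz, hy, e⟩
    refine ⟨Submodule.smul_mem _ c hp, c • z, c • y, ?_, Submodule.smul_mem _ c hy, ?_⟩
    · refine (hz.const_smul c).congr fun t => ?_
      simp only [Prod.smul_fst, map_smul, ← smul_sub]
      rw [smul_comm]
    · rw [Prod.smul_snd, e, smul_add]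

/-- The linear relation `-A = {(x, -y) | (x, y) ∈ A}`. -/
def negRel (A : Submodule ℂ (X × X)) : Submodule ℂ (X × X) :=
  A.comap (LinearMap.prodMap LinearMap.id (-LinearMap.id))

/-- `T` is a degenerate strongly continuous semigroup with generator `B`. -/
def IsDegenerateSemigroupGeneratedBy (T : ℝ≥0 → X →L[ℂ] X) (B : Submodule ℂ (X × X)) : Prop :=
  IsDegenerateSemigroup T ∧ generatorRel T = B

end Semigroups

end

/-!
The proof passes through operator theory on `H` and uses forms only to produce resolvents.

The relation associated with a quasi-sectorial form of vertex `γ` is maximal quasi-accretive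
(`IsMaxQuasiAccretive`): `γ ‖x‖² ≤ Re ⟨y, x⟩` on the relation, and `s - γ + A` is surjective for
`s ≥ 1`. The latter is the Lax-Milgram theorem on the completion `V`, where
`Re ã(u, u) + (1 - γ) ‖j̃ u‖² = ‖u‖²`. For such a relation `A`, let `X` be the closure of its domain
and `P` the orthogonal projection onto `X`. Accretivity in a Hilbert space gives `A(0) = Xᗮ`, and the
resolvents vanish on `Xᗮ`.

* Generation (`IsMaxQuasiAccretive.exists_isDegenerateSemigroupGeneratedBy`): the semigroup is the
  strong limit of `exp(-t Aₙ) P` with the Yosida approximations `Aₙ`. The limit of the generators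
  is identified by the mean value inequality, and a quasi-accretive extension of a maximal
  quasi-accretive relation is trivial.
* Uniqueness and growth (`IsDegenerateSemigroupGeneratedBy.eq_of_isMaxQuasiAccretive`,
  `IsDegenerateSemigroupGeneratedBy.norm_apply_le`): an orbit `u` starting in the domain has a right
  derivative `u'` with `(u, -u') ∈ A`, so that Gronwall's inequality applies to `‖u‖²`.
* Strong convergence of resolvents implies convergence of semigroups
  (`tendstoUniformlyOn_of_tendsto_resolvent`): with `R = (1 - γ + A)⁻¹` and `Rₙ = (1 - γ + Aₙ)⁻¹`, the
  function `w(t) = Rₙ T(t) R f - Tₙ(t) Rₙ R f` solves `w' + Aₙ w ∋ (R - Rₙ) T(t) f`, `w(0) = 0`, and the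
  forcing term tends to `0` uniformly on compact intervals because orbits are compact. This yields
  the convergence on `X`, where `ran R²` is dense. On `Xᗮ` resolvent convergence alone would not
  suffice, but here `dom(aₙ) ⊆ dom(a)` forces `Xₙ ⊆ X`, so all semigroups vanish on `Xᗮ`.
* Convergence of resolvents (`norm_resolvent_formRel_sub_le`, `tendsto_resolvent_formRel`): let `u`
  and `uₙ` solve the limit problem and the approximating problem for the same right hand side. Testing
  with `uₙ - w`, where `w ∈ dom(aₙ)`, bounds the norm of `uₙ - w` in the completion of `dom(aₙ)` by
  `‖u - w‖` and the error `aₙ(w) - a(w)`, since `aₙ - a` is sectorial and hence satisfies a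
  Cauchy-Schwarz inequality. The inclusion of `dom(aₙ)` in `dom(a)` is contractive, so the estimate
  carries over to `V`.
-/

noncomputable section

/-! ### Gronwall estimates for accretive evolutions -/

section Energy

variable {H : Type*} [NormedAddCommGroup H] [InnerProductSpace ℂ H]

/-- Only right derivatives of `u` enter: orbits of a semigroup are right differentiable without any
information on the growth of the semigroup. -/
theorem norm_sq_le_gronwallBound_of_re_inner_deriv_le {u u' : ℝ → H} {K ε b : ℝ}
    (hc : ContinuousOn u (Set.Icc 0 b))
    (hd : ∀ t ∈ Set.Ico 0 b, HasDerivWithinAt u (u' t) (Set.Ici t) t)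
    (hb : ∀ t ∈ Set.Ico 0 b, 2 * (inner ℂ (u t) (u' t)).re ≤ K * ‖u t‖ ^ 2 + ε) :
    ∀ t ∈ Set.Icc 0 b, ‖u t‖ ^ 2 ≤ gronwallBound (‖u 0‖ ^ 2) K ε t := by
  intro t ht
  have hder : ∀ s ∈ Set.Ico 0 b, HasDerivWithinAt (fun r => ‖u r‖ ^ 2)
      (2 * (inner ℂ (u s) (u' s)).re) (Set.Ici s) s := by
    intro s hs
    have h1 := (hd s hs).inner ℂ (hd s hs)
    have h2 := Complex.reCLM.hasFDerivAt.comp_hasDerivWithinAt s h1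
    refine (h2.congr_deriv ?_).congr_of_mem (fun r _ => ?_) Set.self_mem_Ici
    · rw [Complex.reCLM_apply, Complex.add_re, ← inner_conj_symm (u' s) (u s), Complex.conj_re]
      ring
    · exact (inner_self_eq_norm_sq (𝕜 := ℂ) (u r)).symm
  have := le_gronwallBound_of_liminf_deriv_right_le (f := fun r => ‖u r‖ ^ 2)
    (f' := fun s => 2 * (inner ℂ (u s) (u' s)).re) (δ := ‖u 0‖ ^ 2) (K := K) (ε := ε)
    (hc.norm.pow 2) (fun s hs r hr => ?_) le_rfl hb t ht
  · simpa using this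
  · simpa [slope, smul_eq_mul] using (hder s hs).liminf_right_slope_le hr

theorem norm_le_exp_mul_of_re_inner_deriv_le {u u' : ℝ → H} {γ b : ℝ}
    (hc : ContinuousOn u (Set.Icc 0 b))
    (hd : ∀ t ∈ Set.Ico 0 b, HasDerivWithinAt u (u' t) (Set.Ici t) t)
    (hb : ∀ t ∈ Set.Ico 0 b, (inner ℂ (u t) (u' t)).re ≤ -γ * ‖u t‖ ^ 2) :
    ∀ t ∈ Set.Icc 0 b, ‖u t‖ ≤ Real.exp (-γ * t) * ‖u 0‖ := by
  intro t ht
  have := norm_sq_le_gronwallBound_of_re_inner_deriv_le (K := -2 * γ) (ε := 0) hc hd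
    (fun s hs => by linarith [hb s hs]) t ht
  rw [gronwallBound_ε0] at this
  refine le_of_sq_le_sq ?_ (by positivity)
  calc _ ≤ _ := this
    _ = _ := by rw [mul_pow, ← Real.exp_nat_mul]; push_cast; ring_nf

/-- Solutions of `u' + B u = g` that start at `0`, where `B - γ` is accretive, are bounded by the
forcing term `g`: take `η = sup ‖g‖`. -/
theorem norm_le_mul_exp_of_re_inner_deriv_le {u u' : ℝ → H} {γ b η : ℝ} (hη : 0 ≤ η)
    (hc : ContinuousOn u (Set.Icc 0 b))
    (hd : ∀ t ∈ Set.Ico 0 b, HasDerivWithinAt u (u' t) (Set.Ici t) t) (h0 : u 0 = 0)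
    (hb : ∀ t ∈ Set.Ico 0 b, (inner ℂ (u t) (u' t)).re ≤ -γ * ‖u t‖ ^ 2 + η * ‖u t‖) :
    ∀ t ∈ Set.Icc 0 b, ‖u t‖ ≤ η * Real.exp ((1 + 2 * |γ|) * b / 2) := by
  intro t ht
  have hK : 0 < 1 + 2 * |γ| := by positivity
  have := norm_sq_le_gronwallBound_of_re_inner_deriv_le (K := 1 + 2 * |γ|) (ε := η ^ 2) hc hd
    (fun s hs => by
      nlinarith [hb s hs, sq_nonneg (‖u s‖ - η), neg_abs_le γ, sq_nonneg ‖u s‖]) t ht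
  rw [gronwallBound_of_K_ne_0 hK.ne', h0] at this
  refine le_of_sq_le_sq ?_ (by positivity)
  calc ‖u t‖ ^ 2 ≤ η ^ 2 / (1 + 2 * |γ|) * (Real.exp ((1 + 2 * |γ|) * t) - 1) := by
        simpa using this
    _ ≤ η ^ 2 * Real.exp ((1 + 2 * |γ|) * b) := by
        have h1 : η ^ 2 / (1 + 2 * |γ|) ≤ η ^ 2 :=
          div_le_self (sq_nonneg _) (by linarith [abs_nonneg γ])
        have h2 : Real.exp ((1 + 2 * |γ|) * t) - 1 ≤ Real.exp ((1 + 2 * |γ|) * b) := by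
          have : Real.exp ((1 + 2 * |γ|) * t) ≤ Real.exp ((1 + 2 * |γ|) * b) := by
            gcongr; exact ht.2
          linarith
        have h3 : 0 ≤ Real.exp ((1 + 2 * |γ|) * t) - 1 := by
          have : 0 ≤ (1 + 2 * |γ|) * t := mul_nonneg hK.le ht.1
          linarith [Real.one_le_exp this]
        exact mul_le_mul h1 h2 h3 (sq_nonneg _)
    _ = _ := by rw [mul_pow, ← Real.exp_nat_mul]; push_cast; ring_nf

end Energy

/-! ### Maximal quasi-accretive linear relations -/

section Relations

variable {H : Type*} [NormedAddCommGroup H] [InnerProductSpace ℂ H]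

/-- The linear relation `A - γ` is maximal accretive: `γ ‖x‖² ≤ Re ⟨y, x⟩` for `(x, y) ∈ A`, and
`s - γ + A` is surjective for `s ≥ 1`. -/
structure IsMaxQuasiAccretive (A : Submodule ℂ (H × H)) (γ : ℝ) : Prop where
  accretive : ∀ p ∈ A, γ * ‖p.1‖ ^ 2 ≤ (inner ℂ p.1 p.2).re
  surjective : ∀ s : ℝ, 1 ≤ s → ∀ f : H, ∃ x : H, (x, f - ((s - γ : ℝ) : ℂ) • x) ∈ A

/-- The closure of the domain of the linear relation `A`. -/
def relDomClosure (A : Submodule ℂ (H × H)) : Submodule ℂ H :=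
  (A.map (LinearMap.fst ℂ H H)).topologicalClosure

theorem fst_mem_relDomClosure {A : Submodule ℂ (H × H)} {x y : H} (h : (x, y) ∈ A) :
    x ∈ relDomClosure A :=
  Submodule.le_topologicalClosure _ ⟨(x, y), h, rfl⟩

instance [CompleteSpace H] (A : Submodule ℂ (H × H)) : CompleteSpace (relDomClosure A) :=
  inferInstanceAs (CompleteSpace (Submodule.topologicalClosure _))

namespace IsMaxQuasiAccretive

variable {A : Submodule ℂ (H × H)} {γ : ℝ} (h : IsMaxQuasiAccretive A γ)

include h

/-- Elements `x` of the domain with `(s - γ + A) x ∋ f` satisfy `s ‖x‖ ≤ ‖f‖`; this is the resolvent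
estimate and also the injectivity of `s - γ + A`. -/
theorem mul_norm_le {s : ℝ} {x f : H}
    (hx : (x, f - ((s - γ : ℝ) : ℂ) • x) ∈ A) : s * ‖x‖ ≤ ‖f‖ := by
  have h1 := h.accretive _ hx
  simp only [inner_sub_right, inner_smul_right, Complex.sub_re, Complex.re_ofReal_mul] at h1
  have h2 : (inner ℂ x x).re = ‖x‖ ^ 2 := inner_self_eq_norm_sq (𝕜 := ℂ) x
  have h3 : (inner ℂ x f).re ≤ ‖x‖ * ‖f‖ := re_inner_le_norm (𝕜 := ℂ) x f
  rw [h2] at h1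
  rcases eq_or_lt_of_le (norm_nonneg x) with h0 | h0
  · rw [← h0]; simp
  · nlinarith

theorem eq_of_mem {s : ℝ} (hs : 0 < s) {x x' f : H} (hx : (x, f - ((s - γ : ℝ) : ℂ) • x) ∈ A)
    (hx' : (x', f - ((s - γ : ℝ) : ℂ) • x') ∈ A) : x = x' := by
  have h1 : (x - x', (0 : H) - ((s - γ : ℝ) : ℂ) • (x - x')) ∈ A := by
    convert A.sub_mem hx hx' using 1
    rw [Prod.mk_sub_mk, smul_sub]
    congr 1
    abel
  have h2 := h.mul_norm_le h1
  rw [norm_zero] at h2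
  have h3 : ‖x - x'‖ ≤ 0 := by
    by_contra! hlt
    nlinarith
  exact sub_eq_zero.1 (norm_le_zero_iff.1 h3)

omit h in
/-- The resolvent `(s - γ + A)⁻¹` for `s ≥ 1`; it is single-valued by accretivity. -/
def resolvent (h : IsMaxQuasiAccretive A γ) (s : ℝ) (hs : 1 ≤ s) : H →L[ℂ] H :=
  LinearMap.mkContinuous
    { toFun := fun f => (h.surjective s hs f).choose
      map_add' := fun f g => by
        refine h.eq_of_mem (zero_lt_one.trans_le hs) (h.surjective s hs (f + g)).choose_spec ?_
        convert A.add_mem (h.surjective s hs f).choose_spec (h.surjective s hs g).choose_spec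
          using 1
        rw [Prod.mk_add_mk, smul_add]
        congr 1
        abel
      map_smul' := fun c f => by
        refine h.eq_of_mem (zero_lt_one.trans_le hs) (h.surjective s hs (c • f)).choose_spec ?_
        convert A.smul_mem c (h.surjective s hs f).choose_spec using 1
        rw [Prod.smul_mk, smul_sub, RingHom.id_apply, smul_comm c] }
    (1 / s) fun f => by
      have := h.mul_norm_le (h.surjective s hs f).choose_spec
      rw [one_div_mul_eq_div, le_div_iff₀ (zero_lt_one.trans_le hs), mul_comm]
      exact this

theorem resolvent_mem (s : ℝ) (hs : 1 ≤ s) (f : H) :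
    (h.resolvent s hs f, f - ((s - γ : ℝ) : ℂ) • h.resolvent s hs f) ∈ A :=
  (h.surjective s hs f).choose_spec

theorem resolvent_apply_of_mem {s : ℝ} (hs : 1 ≤ s) {x y : H} (hx : (x, y) ∈ A) :
    h.resolvent s hs (y + ((s - γ : ℝ) : ℂ) • x) = x :=
  h.eq_of_mem (zero_lt_one.trans_le hs) (h.resolvent_mem s hs _) (by simpa using hx)

theorem mul_norm_resolvent_le (s : ℝ) (hs : 1 ≤ s) (f : H) : s * ‖h.resolvent s hs f‖ ≤ ‖f‖ :=
  h.mul_norm_le (h.resolvent_mem s hs f)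

theorem mem_iff {s : ℝ} (hs : 1 ≤ s) {x y : H} :
    (x, y) ∈ A ↔ h.resolvent s hs (y + ((s - γ : ℝ) : ℂ) • x) = x := by
  refine ⟨h.resolvent_apply_of_mem hs, fun e => ?_⟩
  have := h.resolvent_mem s hs (y + ((s - γ : ℝ) : ℂ) • x)
  rw [e, add_sub_cancel_right] at this
  exact this

theorem commute_resolvent (s t : ℝ) (hs : 1 ≤ s) (ht : 1 ≤ t) :
    Commute (h.resolvent s hs) (h.resolvent t ht) := by
  -- The resolvent identity `(t - s) R_t R_s = R_s - R_t` shows that `R_t` and `R_s` commute.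
  have key : ∀ (s t : ℝ) (hs : 1 ≤ s) (ht : 1 ≤ t) (f : H),
      ((t - s : ℝ) : ℂ) • h.resolvent t ht (h.resolvent s hs f)
        = h.resolvent s hs f - h.resolvent t ht f := by
    intro s t hs ht f
    have h1 := h.resolvent_apply_of_mem ht (h.resolvent_mem s hs f)
    rw [sub_add, ← sub_smul, map_sub, map_smul] at h1
    have e : ((s - γ : ℝ) : ℂ) - ((t - γ : ℝ) : ℂ) = -((t - s : ℝ) : ℂ) := by
      push_cast; ring
    rw [e, neg_smul, sub_neg_eq_add] at h1
    rw [eq_sub_iff_add_eq, add_comm]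
    exact h1
  ext f
  rcases eq_or_ne s t with rfl | hne
  · rfl
  · have h1 := key s t hs ht f
    have h2 := key t s ht hs f
    have h3 : ((t - s : ℝ) : ℂ) • h.resolvent t ht (h.resolvent s hs f)
        = ((t - s : ℝ) : ℂ) • h.resolvent s hs (h.resolvent t ht f) := by
      rw [h1, ← neg_sub (h.resolvent t ht f), ← h2, ← neg_smul]
      push_cast
      rw [neg_sub]
    have h4 : ((t - s : ℝ) : ℂ) ≠ 0 := by
      rw [Complex.ofReal_ne_zero]; exact sub_ne_zero.2 hne.symm
    exact (smul_right_injective H h4 h3).symm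

theorem inner_eq_zero_of_mem {x z y : H} (hx : (x, z) ∈ A) (hy : (0, y) ∈ A) :
    inner ℂ x y = 0 := by
  -- Accretivity at `(x, z + c y)` for all scalars `c` forces `⟨x, y⟩ = 0`.
  have h1 : ∀ r : ℝ, γ * ‖x‖ ^ 2 ≤ (inner ℂ x z).re - r * ‖inner ℂ x y‖ ^ 2 := by
    intro r
    have hm : (x, z + (-(r : ℂ) * conj (inner ℂ x y)) • y) ∈ A := by
      have := A.add_mem hx (A.smul_mem (-(r : ℂ) * conj (inner ℂ x y)) hy)
      simpa using this
    have h2 := h.accretive _ hm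
    simp only [inner_add_right, inner_smul_right] at h2
    have e : -(r : ℂ) * conj (inner ℂ x y) * inner ℂ x y
        = ((-r * ‖inner ℂ x y‖ ^ 2 : ℝ) : ℂ) := by
      rw [mul_assoc, Complex.conj_mul']; push_cast; ring
    rw [e, Complex.add_re, Complex.ofReal_re] at h2
    linarith
  by_contra hne
  have hpos : 0 < ‖inner ℂ x y‖ ^ 2 := by positivity
  have h2 := h1 (((inner ℂ x z).re - γ * ‖x‖ ^ 2 + 1) / ‖inner ℂ x y‖ ^ 2)
  rw [div_mul_cancel₀ _ hpos.ne'] at h2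
  linarith

theorem resolvent_eq_zero {s : ℝ} (hs : 1 ≤ s) {y : H} (hy : y ∈ (relDomClosure A)ᗮ) :
    h.resolvent s hs y = 0 := by
  have hm := h.resolvent_mem s hs y
  have h0 : inner ℂ (h.resolvent s hs y) y = 0 :=
    (Submodule.mem_orthogonal _ _).1 hy _ (fst_mem_relDomClosure hm)
  have h1 := h.accretive _ hm
  have h2 : (inner ℂ (h.resolvent s hs y) (h.resolvent s hs y)).re
      = ‖h.resolvent s hs y‖ ^ 2 := inner_self_eq_norm_sq (𝕜 := ℂ) _
  simp only [inner_sub_right, inner_smul_right, Complex.sub_re, Complex.re_ofReal_mul, h0, h2,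
    Complex.zero_re] at h1
  have h3 : ‖h.resolvent s hs y‖ ^ 2 ≤ 0 := by
    by_contra! hlt
    nlinarith
  simpa using h3

theorem zero_mem_iff {y : H} : (0, y) ∈ A ↔ y ∈ (relDomClosure A)ᗮ := by
  constructor
  · intro hy
    rw [relDomClosure, Submodule.orthogonal_closure, Submodule.mem_orthogonal]
    rintro _ ⟨⟨x, z⟩, hx, rfl⟩
    exact h.inner_eq_zero_of_mem hx hy
  · intro hy
    have := h.resolvent_mem 1 le_rfl y
    rw [h.resolvent_eq_zero le_rfl hy] at this
    simpa using this

/-- A relation with a maximal quasi-accretive restriction is equal to it as soon as it is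
quasi-accretive itself. -/
theorem eq_of_le {B : Submodule ℂ (H × H)} (hAB : A ≤ B)
    (hB : ∀ p ∈ B, γ * ‖p.1‖ ^ 2 ≤ (inner ℂ p.1 p.2).re) : A = B := by
  have h' : IsMaxQuasiAccretive B γ :=
    ⟨hB, fun s hs f => (h.surjective s hs f).imp fun x hx => hAB hx⟩
  refine le_antisymm hAB ?_
  rintro ⟨x, y⟩ hxy
  rw [h.mem_iff le_rfl]
  exact h'.eq_of_mem one_pos (hAB (h.resolvent_mem 1 le_rfl _)) (by simpa using hxy)

end IsMaxQuasiAccretive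

end Relations

/-! ### Uniform convergence of bounded families of operators -/

section UniformConvergence

variable {X : Type*} [NormedAddCommGroup X] [NormedSpace ℂ X]

theorem isClosed_setOf_tendstoUniformlyOn {ι κ : Type*} {l : Filter ι} {F : ι → κ → X →L[ℂ] X}
    {G : κ → X →L[ℂ] X} {S : Set κ} {M : ℝ} (hF : ∀ i, ∀ t ∈ S, ∀ x, ‖F i t x‖ ≤ M * ‖x‖)
    (hG : ∀ t ∈ S, ∀ x, ‖G t x‖ ≤ M * ‖x‖) :
    IsClosed {x | TendstoUniformlyOn (fun i t => F i t x) (fun t => G t x) l S} := by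
  refine isClosed_of_closure_subset fun x hx => ?_
  rw [Set.mem_ofPred_eq, Metric.tendstoUniformlyOn_iff]
  intro ε hε
  obtain ⟨y, hy, hxy⟩ := Metric.mem_closure_iff.1 hx (ε / (3 * (|M| + 1))) (by positivity)
  rw [Set.mem_ofPred_eq, Metric.tendstoUniformlyOn_iff] at hy
  have hM : M * ‖x - y‖ ≤ ε / 3 := by
    rw [dist_eq_norm, lt_div_iff₀ (by positivity)] at hxy
    nlinarith [le_abs_self M, norm_nonneg (x - y)]
  filter_upwards [hy (ε / 3) (by positivity)] with i hi t ht
  have h1 := hi t ht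
  have h2 := (hF i t ht (x - y)).trans hM
  have h3 := (hG t ht (x - y)).trans hM
  rw [dist_eq_norm] at h1 ⊢
  calc ‖G t x - F i t x‖ = ‖(G t y - F i t y) + G t (x - y) - F i t (x - y)‖ := by
        congr 1; simp only [map_sub]; abel
    _ ≤ ‖G t y - F i t y‖ + ‖G t (x - y)‖ + ‖F i t (x - y)‖ :=
        (norm_sub_le _ _).trans (by gcongr; exact norm_add_le _ _)
    _ < ε := by linarith

theorem tendstoUniformlyOn_zero_of_isCompact {ι : Type*} {l : Filter ι} {L : ι → X →L[ℂ] X} {M : ℝ}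
    (hM : ∀ i x, ‖L i x‖ ≤ M * ‖x‖) (hL : ∀ x, Tendsto (fun i => L i x) l (𝓝 0)) {Q : Set X}
    (hQ : IsCompact Q) : TendstoUniformlyOn (fun i x => L i x) 0 l Q := by
  rw [Metric.tendstoUniformlyOn_iff]
  intro ε hε
  obtain ⟨t, -, hfin, hcov⟩ := hQ.finite_cover_balls (e := ε / (2 * (|M| + 1))) (by positivity)
  have hev : ∀ᶠ i in l, ∀ y ∈ t, ‖L i y‖ < ε / 2 := by
    rw [eventually_all_finite hfin]
    intro y _
    have := (hL y).norm
    rw [norm_zero] at this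
    exact this.eventually (gt_mem_nhds (by positivity))
  filter_upwards [hev] with i hi x hx
  obtain ⟨y, hy, hxy⟩ := Set.mem_iUnion₂.1 (hcov hx)
  rw [Metric.mem_ball, dist_eq_norm, lt_div_iff₀ (by positivity)] at hxy
  have h1 := hM i (x - y)
  have h2 := hi y hy
  rw [Pi.zero_apply, dist_zero_left]
  calc ‖L i x‖ = ‖L i (x - y) + L i y‖ := by rw [map_sub, sub_add_cancel]
    _ ≤ ‖L i (x - y)‖ + ‖L i y‖ := norm_add_le _ _
    _ < ε := by nlinarith [le_abs_self M, norm_nonneg (x - y)]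

end UniformConvergence

/-! ### Orbits of degenerate semigroups -/

namespace IsDegenerateSemigroup

variable {X : Type*} [NormedAddCommGroup X] [NormedSpace ℂ X] {T : ℝ≥0 → X →L[ℂ] X}
  (hT : IsDegenerateSemigroup T)

include hT

theorem apply_add (s t : ℝ≥0) (x : X) : T (s + t) x = T s (T t x) := by
  rw [hT.map_add]; rfl

theorem apply_zero_apply (t : ℝ≥0) (x : X) : T t (T 0 x) = T t x := by
  rw [← hT.apply_add, add_zero]

theorem zero_apply_apply (t : ℝ≥0) (x : X) : T 0 (T t x) = T t x := by
  rw [← hT.apply_add, zero_add]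

theorem apply_eq_zero {x : X} (hx : T 0 x = 0) (t : ℝ≥0) : T t x = 0 := by
  rw [← hT.apply_zero_apply, hx, map_zero]

theorem zero_apply_of_mem_range {x : X} (hx : x ∈ (T 0).range) : T 0 x = x := by
  obtain ⟨y, rfl⟩ := hx
  exact hT.zero_apply_apply 0 y

theorem tendsto_nhds_zero (x : X) : Tendsto (fun t => T t x) (𝓝 0) (𝓝 (T 0 x)) := by
  have h : ContinuousWithinAt (fun t => T t x) (Set.Ici 0) 0 :=
    continuousWithinAt_Ioi_iff_Ici.1 (hT.tendsto_zero x)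
  have e : (Set.Ici 0 : Set ℝ≥0) = Set.univ := Set.eq_univ_of_forall fun t => Set.mem_Ici.2 zero_le
  rw [e, continuousWithinAt_univ] at h
  exact h

variable [CompleteSpace X]

/-- Strong convergence at `0` and the uniform boundedness principle give a local bound. -/
theorem exists_norm_le_near_zero : ∃ δ : ℝ≥0, 0 < δ ∧ ∃ M : ℝ, 1 ≤ M ∧ ∀ t ≤ δ, ‖T t‖ ≤ M := by
  by_contra! hcon
  have h1 : ∀ n : ℕ, ∃ t : ℝ≥0, t ≤ 1 / ((n : ℝ≥0) + 1) ∧ (n : ℝ) + 1 < ‖T t‖ := fun n =>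
    hcon (1 / ((n : ℝ≥0) + 1)) (by positivity) (n + 1) (by linarith [Nat.cast_nonneg (α := ℝ) n])
  choose t ht hTt using h1
  have h0 : Tendsto t atTop (𝓝 0) :=
    tendsto_of_tendsto_of_tendsto_of_le_of_le tendsto_const_nhds
      tendsto_one_div_add_atTop_nhds_zero_nat (fun n => zero_le) ht
  obtain ⟨C, hC⟩ := banach_steinhaus (g := fun n => T (t n)) fun x => by
    obtain ⟨C, hC⟩ := isBounded_iff_forall_norm_le.1
      (Metric.isBounded_range_of_tendsto _ ((hT.tendsto_nhds_zero x).comp h0))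
    exact ⟨C, fun n => hC _ ⟨n, rfl⟩⟩
  obtain ⟨n, hn⟩ := exists_nat_gt C
  linarith [hC n, hTt n]

theorem exists_norm_le (b : ℝ≥0) : ∃ M : ℝ, 0 ≤ M ∧ ∀ t ≤ b, ‖T t‖ ≤ M := by
  obtain ⟨δ, hδ, M, hM, hb⟩ := hT.exists_norm_le_near_zero
  have key : ∀ n : ℕ, ∀ t ≤ n * δ, ‖T t‖ ≤ M ^ (n + 1) := by
    intro n
    induction n with
    | zero => intro t ht; simpa using hb t (by simp at ht; simp [ht])
    | succ n ih =>
      intro t ht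
      rcases le_total t δ with h | h
      · exact (hb t h).trans (le_self_pow₀ hM (by simp))
      · have e : t = δ + (t - δ) := (add_tsub_cancel_of_le h).symm
        have h2 : t - δ ≤ n * δ := by
          rw [tsub_le_iff_right]
          push_cast at ht
          linarith
        rw [e, hT.map_add, pow_succ' M (n + 1)]
        exact (ContinuousLinearMap.opNorm_comp_le _ _).trans
          (mul_le_mul (hb δ le_rfl) (ih _ h2) (norm_nonneg _) (by linarith))
  obtain ⟨n, hn⟩ := exists_nat_ge (b / δ)
  refine ⟨M ^ (n + 1), by positivity, fun t ht => key n t (ht.trans ?_)⟩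
  rwa [div_le_iff₀ hδ] at hn

theorem continuous_apply (x : X) : Continuous fun t => T t x := by
  rw [continuous_iff_continuousAt]
  intro t
  obtain ⟨M, hM, hb⟩ := hT.exists_norm_le (t + 1)
  -- `‖T(s) x - T(t) x‖ ≤ M ‖T(|s - t|) x - T(0) x‖`, whichever of `s` and `t` is larger
  have key : ∀ s r : ℝ≥0, s ≤ t + 1 → s ≤ r →
      ‖T s x - T r x‖ ≤ M * ‖T (nndist s r) x - T 0 x‖ := by
    intro s r hs hr
    have e : nndist s r = r - s := by
      rw [NNReal.nndist_eq, tsub_eq_zero_of_le hr, max_eq_right zero_le]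
    have e2 : T s x - T r x = T s (T 0 x - T (r - s) x) := by
      rw [map_sub, ← hT.apply_add, ← hT.apply_add, add_zero, add_tsub_cancel_of_le hr]
    rw [e2, e, norm_sub_rev (T (r - s) x)]
    exact ContinuousLinearMap.le_of_opNorm_le _ (hb s hs) _
  have hlim : Tendsto (fun s => M * ‖T (nndist s t) x - T 0 x‖) (𝓝 t) (𝓝 0) := by
    have h0 : Tendsto (fun s => nndist s t) (𝓝 t) (𝓝 0) := by
      have : Continuous fun s => nndist s t := by fun_prop
      simpa using this.tendsto t
    have h1 := (((hT.tendsto_nhds_zero x).comp h0).sub_const (T 0 x)).norm.const_mul M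
    simpa using h1
  rw [ContinuousAt, tendsto_iff_norm_sub_tendsto_zero]
  refine squeeze_zero' (Eventually.of_forall fun s => norm_nonneg _) ?_ hlim
  filter_upwards [Iic_mem_nhds (show t < t + 1 by simp)] with s hs
  rcases le_total s t with h | h
  · exact key s t hs h
  · rw [norm_sub_rev, nndist_comm]
    exact key t s (by simp) h

theorem continuous_apply_toNNReal (x : X) : Continuous fun t : ℝ => T t.toNNReal x :=
  (hT.continuous_apply x).comp continuous_real_toNNReal

omit [CompleteSpace X]

theorem hasDerivWithinAt {x z : X}
    (hz : Tendsto (fun t : ℝ≥0 => (((t : ℝ) : ℂ)⁻¹) • (T t x - x)) (𝓝[>] 0) (𝓝 z))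
    {t : ℝ} (ht : 0 ≤ t) :
    HasDerivWithinAt (fun s : ℝ => T s.toNNReal x) (T t.toNNReal z) (Set.Ici t) t := by
  rw [← hasDerivWithinAt_Ioi_iff_Ici, hasDerivWithinAt_iff_tendsto_slope' (by simp)]
  have h1 : Tendsto (fun s : ℝ => (s - t).toNNReal) (𝓝[>] t) (𝓝[>] 0) := by
    refine tendsto_nhdsWithin_iff.2 ⟨?_, ?_⟩
    · have : Continuous fun s : ℝ => (s - t).toNNReal := by fun_prop
      have := this.tendsto t
      simp only [sub_self, Real.toNNReal_zero] at this
      exact this.mono_left nhdsWithin_le_nhds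
    · filter_upwards [self_mem_nhdsWithin] with s hs
      simpa using hs
  refine ((((T t.toNNReal).continuous.tendsto z).comp hz).comp h1).congr' ?_
  filter_upwards [self_mem_nhdsWithin] with s hs
  have hst : 0 ≤ s - t := by linarith [Set.mem_Ioi.1 hs]
  have e : s.toNNReal = t.toNNReal + (s - t).toNNReal := by
    rw [← Real.toNNReal_add ht hst]; congr 1; ring
  simp only [Function.comp_apply, map_smul, map_sub, slope, vsub_eq_sub]
  rw [e, hT.apply_add, Real.coe_toNNReal _ hst, ← Complex.ofReal_inv, Complex.coe_smul]

end IsDegenerateSemigroup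

section Generated

variable {H : Type*} [NormedAddCommGroup H] [InnerProductSpace ℂ H]

theorem mem_negRel {A : Submodule ℂ (H × H)} {x y : H} : (x, y) ∈ negRel A ↔ (x, -y) ∈ A :=
  Iff.rfl

theorem relDomClosure_induction {A : Submodule ℂ (H × H)} {p : H → Prop}
    (hp : IsClosed {x | p x}) (h : ∀ x y, (x, y) ∈ A → p x) {x : H}
    (hx : x ∈ relDomClosure A) : p x := by
  refine closure_minimal (s := (A.map (LinearMap.fst ℂ H H) : Set H)) ?_ hp hx
  rintro _ ⟨⟨x, y⟩, hxy, rfl⟩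
  exact h x y hxy

namespace IsDegenerateSemigroupGeneratedBy

variable {A : Submodule ℂ (H × H)} {T T' : ℝ≥0 → H →L[ℂ] H}
  (hT : IsDegenerateSemigroupGeneratedBy T (negRel A))

include hT

theorem zero_apply_of_mem {x y : H} (hx : (x, y) ∈ A) : T 0 x = x := by
  have : (x, -y) ∈ generatorRel T := by rw [hT.2, mem_negRel, neg_neg]; exact hx
  exact hT.1.zero_apply_of_mem_range this.1

theorem tendsto_of_mem {x y : H} (hx : (x, y) ∈ A) :
    Tendsto (fun t : ℝ≥0 => (((t : ℝ) : ℂ)⁻¹) • (T t x - x)) (𝓝[>] 0) (𝓝 (-T 0 y)) := by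
  have h1 : (x, -y) ∈ generatorRel T := by rw [hT.2, mem_negRel, neg_neg]; exact hx
  obtain ⟨-, z, k, hz, hk, e⟩ := h1
  have hz' := ((T 0).continuous.tendsto z).comp hz
  have h2 : T 0 z = z := by
    refine tendsto_nhds_unique (hz'.congr fun t => ?_) hz
    simp only [Function.comp_apply, map_smul, map_sub]
    rw [hT.1.zero_apply_apply, hT.zero_apply_of_mem hx]
  have h3 : -T 0 y = z := by
    have hk' : T 0 k = 0 := hk
    have e' : -y = z + k := e
    rw [← map_neg, e', map_add, hk', h2, add_zero]
  rwa [h3]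

theorem hasDerivWithinAt {x y : H} (hx : (x, y) ∈ A) {t : ℝ} (ht : 0 ≤ t) :
    HasDerivWithinAt (fun s : ℝ => T s.toNNReal x) (-T t.toNNReal y) (Set.Ici t) t := by
  have := hT.1.hasDerivWithinAt (hT.tendsto_of_mem hx) ht
  rwa [map_neg, hT.1.apply_zero_apply] at this

theorem apply_mem {x y : H} (hx : (x, y) ∈ A) (t : ℝ≥0) : (T t x, T t y) ∈ A := by
  have h1 : (T t x, -T t y) ∈ generatorRel T := by
    refine ⟨⟨T t x, hT.1.zero_apply_apply t x⟩, -T t y, 0, ?_, map_zero _, by simp⟩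
    have h2 := ((T t).continuous.tendsto _).comp (hT.tendsto_of_mem hx)
    rw [map_neg, hT.1.apply_zero_apply] at h2
    refine h2.congr fun s => ?_
    simp only [Function.comp_apply, map_smul, map_sub]
    rw [← hT.1.apply_add, ← hT.1.apply_add, add_comm]
  rw [hT.2, mem_negRel, neg_neg] at h1
  exact h1

variable {γ : ℝ} (hA : IsMaxQuasiAccretive A γ)

include hA

/-- Together with `zero_apply_of_mem` this determines `T(0)`: it is the orthogonal projection onto
the closure of the domain. -/
theorem zero_apply_of_mem_orthogonal {y : H} (hy : y ∈ (relDomClosure A)ᗮ) : T 0 y = 0 := by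
  have h1 : (0, -y) ∈ generatorRel T := by
    rw [hT.2, mem_negRel, neg_neg]
    exact hA.zero_mem_iff.2 hy
  obtain ⟨-, z, k, hz, hk, e⟩ := h1
  have hz0 : z = 0 := by
    refine tendsto_nhds_unique hz ?_
    simp
  have hk' : T 0 k = 0 := hk
  have e' : -y = z + k := e
  rw [hz0, zero_add] at e'
  rwa [← e', map_neg, neg_eq_zero] at hk'

theorem apply_resolvent (t : ℝ≥0) (f : H) :
    T t (hA.resolvent 1 le_rfl f) = hA.resolvent 1 le_rfl (T t f) := by
  have := hA.resolvent_apply_of_mem le_rfl (hT.apply_mem (hA.resolvent_mem 1 le_rfl f) t)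
  rw [map_sub, map_smul, sub_add_cancel] at this
  exact this.symm

variable [CompleteSpace H]

theorem apply_starProjection (t : ℝ≥0) (x : H) :
    T t ((relDomClosure A).starProjection x) = T t x := by
  rw [← hT.1.apply_zero_apply, ← hT.1.apply_zero_apply t x]
  congr 1
  rw [← sub_eq_zero, ← map_sub]
  apply hT.zero_apply_of_mem_orthogonal hA
  rw [← neg_mem_iff, neg_sub]
  exact Submodule.sub_starProjection_mem_orthogonal x

theorem norm_apply_le (t : ℝ≥0) (x : H) : ‖T t x‖ ≤ Real.exp (-γ * t) * ‖x‖ := by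
  have key : ∀ x ∈ relDomClosure A, ‖T t x‖ ≤ Real.exp (-γ * t) * ‖x‖ := by
    refine fun x hx => relDomClosure_induction
      (p := fun x => ‖T t x‖ ≤ Real.exp (-γ * t) * ‖x‖)
      (isClosed_le (by fun_prop) (by fun_prop)) (fun x y hxy => ?_) hx
    have := norm_le_exp_mul_of_re_inner_deriv_le (γ := γ) (b := t)
      (hT.1.continuous_apply_toNNReal x).continuousOn
      (fun s hs => hT.hasDerivWithinAt hxy hs.1)
      (fun s _ => by
        have := hA.accretive _ (hT.apply_mem hxy s.toNNReal)
        rw [inner_neg_right, Complex.neg_re]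
        linarith) t ⟨t.2, le_rfl⟩
    simpa [hT.zero_apply_of_mem hxy] using this
  rw [← hT.apply_starProjection hA]
  refine (key _ (Submodule.starProjection_apply_mem _ x)).trans ?_
  gcongr
  exact Submodule.norm_starProjection_apply_le _ x

theorem eq_of_isMaxQuasiAccretive
    (hT' : IsDegenerateSemigroupGeneratedBy T' (negRel A)) : T = T' := by
  have key : ∀ (t : ℝ≥0), ∀ x ∈ relDomClosure A, T t x = T' t x := by
    refine fun t x hx => relDomClosure_induction (p := fun x => T t x = T' t x)
      (isClosed_eq (by fun_prop) (by fun_prop)) (fun x y hxy => ?_) hx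
    have := norm_le_exp_mul_of_re_inner_deriv_le (γ := γ) (b := t)
      ((hT.1.continuous_apply_toNNReal x).sub (hT'.1.continuous_apply_toNNReal x)).continuousOn
      (fun s hs => (hT.hasDerivWithinAt hxy hs.1).sub (hT'.hasDerivWithinAt hxy hs.1))
      (fun s _ => by
        have := hA.accretive _ (A.sub_mem (hT.apply_mem hxy s.toNNReal)
          (hT'.apply_mem hxy s.toNNReal))
        simp only [Prod.mk_sub_mk] at this
        rw [← neg_sub', inner_neg_right, Complex.neg_re, Pi.sub_apply]
        linarith) t ⟨t.2, le_rfl⟩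
    simpa [hT.zero_apply_of_mem hxy, hT'.zero_apply_of_mem hxy, sub_eq_zero] using this
  funext t
  ext x
  rw [← hT.apply_starProjection hA, ← hT'.apply_starProjection hA]
  exact key t _ (Submodule.starProjection_apply_mem _ x)

end IsDegenerateSemigroupGeneratedBy

/-! ### Convergence of resolvents and of degenerate semigroups -/

variable [CompleteSpace H]

/-- With `R = (1 - γ + A)⁻¹` and `R' = (1 - γ + A')⁻¹`, the function
`w(t) = R' T(t) R f - T'(t) R' R f` satisfies `w(0) = 0` and `-w'(t) + (R - R') T(t) f ∈ A' w(t)`,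
which is where the estimate comes from. -/
theorem norm_resolvent_comp_sub_le {A A' : Submodule ℂ (H × H)} {γ : ℝ}
    (hA : IsMaxQuasiAccretive A γ) (hA' : IsMaxQuasiAccretive A' γ) {T T' : ℝ≥0 → H →L[ℂ] H}
    (hT : IsDegenerateSemigroupGeneratedBy T (negRel A))
    (hT' : IsDegenerateSemigroupGeneratedBy T' (negRel A')) {f : H} {b : ℝ≥0} {η : ℝ} (hη : 0 ≤ η)
    (hb : ∀ t ≤ b, ‖hA.resolvent 1 le_rfl (T t f) - hA'.resolvent 1 le_rfl (T t f)‖ ≤ η) :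
    ∀ t ≤ b, ‖hA'.resolvent 1 le_rfl (T t (hA.resolvent 1 le_rfl f))
      - T' t (hA'.resolvent 1 le_rfl (hA.resolvent 1 le_rfl f))‖
      ≤ η * Real.exp ((1 + 2 * |γ|) * b / 2) := by
  intro t ht
  set R := hA.resolvent 1 le_rfl with hR
  set R' := hA'.resolvent 1 le_rfl with hR'
  have hm := hA.resolvent_mem 1 le_rfl f
  have hm' := hA'.resolvent_mem 1 le_rfl (R f)
  rw [← hR] at hm
  rw [← hR'] at hm'
  have := norm_le_mul_exp_of_re_inner_deriv_le (γ := γ) (b := b) hη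
    (u := fun s : ℝ => R' (T s.toNNReal (R f)) - T' s.toNNReal (R' (R f)))
    (u' := fun s : ℝ => R' (-T s.toNNReal (f - ((1 - γ : ℝ) : ℂ) • R f))
      - -T' s.toNNReal (R f - ((1 - γ : ℝ) : ℂ) • R' (R f)))
    ((R'.continuous.comp (hT.1.continuous_apply_toNNReal _)).sub
      (hT'.1.continuous_apply_toNNReal _)).continuousOn
    (fun s hs => ((R'.restrictScalars ℝ).hasFDerivAt.comp_hasDerivWithinAt s
      (hT.hasDerivWithinAt hm hs.1)).sub (hT'.hasDerivWithinAt hm' hs.1)) ?_ ?_ t ⟨t.2, ht⟩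
  · simpa using this
  · simp only [Real.toNNReal_zero]
    rw [hT.zero_apply_of_mem hm, hT'.zero_apply_of_mem hm', sub_self]
  · intro s hs
    have hsb : s.toNNReal ≤ b := by
      rw [Real.toNNReal_le_iff_le_coe]; exact hs.2.le
    set τ := s.toNNReal
    set g := R (T τ f) - R' (T τ f) with hg
    set w := R' (T τ (R f)) - T' τ (R' (R f)) with hw
    set w' := R' (-T τ (f - ((1 - γ : ℝ) : ℂ) • R f))
      - -T' τ (R f - ((1 - γ : ℝ) : ℂ) • R' (R f)) with hw'
    have h1 : (w, g - w') ∈ A' := by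
      have := A'.sub_mem (hA'.resolvent_mem 1 le_rfl (T τ (R f))) (hT'.apply_mem hm' τ)
      rw [← hR', Prod.mk_sub_mk, ← hw] at this
      convert this using 2
      rw [hg, hw', hT.apply_resolvent hA τ f]
      simp only [map_sub, map_smul, map_neg]
      rw [hT.apply_resolvent hA τ f]
      abel
    have h2 := hA'.accretive _ h1
    simp only [inner_sub_right, Complex.sub_re] at h2
    have h3 : (inner ℂ w g).re ≤ ‖w‖ * ‖g‖ := re_inner_le_norm (𝕜 := ℂ) w g
    have h4 : ‖w‖ * ‖g‖ ≤ ‖w‖ * η := mul_le_mul_of_nonneg_left (hb τ hsb) (norm_nonneg _)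
    show (inner ℂ w w').re ≤ -γ * ‖w‖ ^ 2 + η * ‖w‖
    linarith

/-- Strong resolvent convergence implies convergence of the degenerate semigroups, locally uniformly
on `[0, ∞)`, provided that the approximating relations live on subspaces of the closure of the
domain of the limit: on the orthogonal complement all the semigroups are then `0`. -/
theorem tendstoUniformlyOn_of_tendsto_resolvent {A : Submodule ℂ (H × H)}
    {An : ℕ → Submodule ℂ (H × H)} {γ : ℝ} (hA : IsMaxQuasiAccretive A γ)
    (hAn : ∀ n, IsMaxQuasiAccretive (An n) γ)
    (hdom : ∀ n, relDomClosure (An n) ≤ relDomClosure A)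
    (hres : ∀ f, Tendsto (fun n => (hAn n).resolvent 1 le_rfl f) atTop
      (𝓝 (hA.resolvent 1 le_rfl f)))
    {T : ℝ≥0 → H →L[ℂ] H} {Tn : ℕ → ℝ≥0 → H →L[ℂ] H}
    (hT : IsDegenerateSemigroupGeneratedBy T (negRel A))
    (hTn : ∀ n, IsDegenerateSemigroupGeneratedBy (Tn n) (negRel (An n))) (x : H) (b : ℝ≥0) :
    TendstoUniformlyOn (fun n t => Tn n t x) (fun t => T t x) atTop (Set.Iic b) := by
  set R := hA.resolvent 1 le_rfl with hR
  have hexp : ∀ t ∈ Set.Iic b, Real.exp (-γ * t) ≤ Real.exp (|γ| * b) := by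
    intro t ht
    gcongr
    · exact neg_le_abs γ
    · exact ht
  have hclosed := isClosed_setOf_tendstoUniformlyOn (l := atTop) (F := Tn) (G := T) (S := Set.Iic b)
    (M := Real.exp (|γ| * b))
    (fun n t ht x => ((hTn n).norm_apply_le (hAn n) t x).trans
      (mul_le_mul_of_nonneg_right (hexp t ht) (norm_nonneg _)))
    (fun t ht x => (hT.norm_apply_le hA t x).trans
      (mul_le_mul_of_nonneg_right (hexp t ht) (norm_nonneg _)))
  -- by compactness of orbits, the resolvents converge uniformly on them
  have hunif : ∀ g : H, ∀ ε > 0, ∀ᶠ n in atTop, ∀ t ≤ b,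
      ‖R (T t g) - (hAn n).resolvent 1 le_rfl (T t g)‖ ≤ ε := by
    intro g ε hε
    have hQ : IsCompact ((fun t => T t g) '' Set.Icc 0 b) :=
      isCompact_Icc.image (hT.1.continuous_apply g)
    have h1 := tendstoUniformlyOn_zero_of_isCompact (l := atTop)
      (L := fun n => R - (hAn n).resolvent 1 le_rfl) (M := 2) (fun n x => by
        have h1 := hA.mul_norm_resolvent_le 1 le_rfl x
        have h2 := (hAn n).mul_norm_resolvent_le 1 le_rfl x
        rw [sub_apply]
        exact (norm_sub_le _ _).trans (by linarith))
      (fun x => by simpa using (hres x).const_sub (R x)) hQ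
    rw [Metric.tendstoUniformlyOn_iff] at h1
    filter_upwards [h1 ε hε] with n hn t ht
    have := hn _ ⟨t, ⟨zero_le, ht⟩, rfl⟩
    rw [Pi.zero_apply, dist_zero_left] at this
    exact this.le
  have hRR : ∀ f, TendstoUniformlyOn (fun n t => Tn n t (R (R f))) (fun t => T t (R (R f)))
      atTop (Set.Iic b) := by
    intro f
    rw [Metric.tendstoUniformlyOn_iff]
    intro ε hε
    have e1 := hunif f (ε / 4 / Real.exp ((1 + 2 * |γ|) * b / 2)) (by positivity)
    have e2 := hunif (R f) (ε / 4) (by positivity)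
    have e3 : ∀ᶠ n in atTop,
        ‖R (R f) - (hAn n).resolvent 1 le_rfl (R f)‖ < ε / 4 / Real.exp (|γ| * b) := by
      have h0 : 0 < ε / 4 / Real.exp (|γ| * b) := by positivity
      have h1 := ((hres (R f)).const_sub (R (R f))).norm
      rw [sub_self, norm_zero] at h1
      exact h1.eventually (gt_mem_nhds h0)
    filter_upwards [e1, e2, e3] with n h1 h2 h3 t ht
    have h4 := norm_resolvent_comp_sub_le hA (hAn n) hT (hTn n) (f := f) (by positivity) h1 t ht
    rw [div_mul_cancel₀ _ (Real.exp_pos _).ne'] at h4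
    have h5 := h2 t ht
    have h6 : ‖Tn n t (R (R f) - (hAn n).resolvent 1 le_rfl (R f))‖ ≤ ε / 4 := by
      refine ((hTn n).norm_apply_le (hAn n) t _).trans ?_
      calc _ ≤ Real.exp (|γ| * b) * (ε / 4 / Real.exp (|γ| * b)) :=
            mul_le_mul (hexp t ht) h3.le (norm_nonneg _) (Real.exp_pos _).le
        _ = ε / 4 := mul_div_cancel₀ _ (Real.exp_pos _).ne'
    rw [dist_eq_norm, hT.apply_resolvent hA]
    calc ‖R (T t (R f)) - Tn n t (R (R f))‖
        = ‖(R (T t (R f)) - (hAn n).resolvent 1 le_rfl (T t (R f)))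
          + ((hAn n).resolvent 1 le_rfl (T t (R f))
            - Tn n t ((hAn n).resolvent 1 le_rfl (R f)))
          - Tn n t (R (R f) - (hAn n).resolvent 1 le_rfl (R f))‖ := by
          congr 1; rw [map_sub]; abel
      _ ≤ ε / 4 + ε / 4 + ε / 4 := by
          refine (norm_sub_le _ _).trans (add_le_add ((norm_add_le _ _).trans ?_) h6)
          exact add_le_add h5 h4
      _ < ε := by linarith
  -- `ran R²` is dense in the closure of the domain of `A`
  have hX : ∀ x ∈ relDomClosure A,
      TendstoUniformlyOn (fun n t => Tn n t x) (fun t => T t x) atTop (Set.Iic b) := by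
    have hRX : ∀ x ∈ relDomClosure A,
        TendstoUniformlyOn (fun n t => Tn n t (R x)) (fun t => T t (R x)) atTop (Set.Iic b) := by
      refine fun x hx => relDomClosure_induction
        (p := fun x => TendstoUniformlyOn (fun n t => Tn n t (R x)) (fun t => T t (R x))
          atTop (Set.Iic b)) (hclosed.preimage R.continuous) (fun x y hxy => ?_) hx
      have := hRR (y + ((1 - γ : ℝ) : ℂ) • x)
      rwa [hR, hA.resolvent_apply_of_mem le_rfl hxy] at this
    refine fun x hx => relDomClosure_induction (p := fun x => TendstoUniformlyOn
      (fun n t => Tn n t x) (fun t => T t x) atTop (Set.Iic b)) hclosed (fun x y hxy => ?_) hx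
    have h1 := hRX _ (Submodule.starProjection_apply_mem (relDomClosure A)
      (y + ((1 - γ : ℝ) : ℂ) • x))
    have h2 := hA.resolvent_eq_zero le_rfl (Submodule.sub_starProjection_mem_orthogonal
      (K := relDomClosure A) (y + ((1 - γ : ℝ) : ℂ) • x))
    rw [map_sub, hA.resolvent_apply_of_mem le_rfl hxy, sub_eq_zero] at h2
    rwa [hR, ← h2] at h1
  have hx := hX _ (Submodule.starProjection_apply_mem (relDomClosure A) x)
  have h0 : x - (relDomClosure A).starProjection x ∈ (relDomClosure A)ᗮ :=
    Submodule.sub_starProjection_mem_orthogonal x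
  have e : ∀ t, T t ((relDomClosure A).starProjection x) = T t x := fun t =>
    hT.apply_starProjection hA t x
  have en : ∀ n t, Tn n t ((relDomClosure A).starProjection x) = Tn n t x := by
    intro n t
    have := (hTn n).1.apply_eq_zero ((hTn n).zero_apply_of_mem_orthogonal (hAn n)
      (Submodule.orthogonal_le (hdom n) h0)) t
    rw [map_sub, sub_eq_zero] at this
    exact this.symm
  simpa only [e, en] using hx

end Generated

/-! ### Generation of degenerate semigroups -/

namespace IsMaxQuasiAccretive

variable {H : Type*} [NormedAddCommGroup H] [InnerProductSpace ℂ H]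
  {A : Submodule ℂ (H × H)} {γ : ℝ} (h : IsMaxQuasiAccretive A γ)

/-- The resolvent `(n + 1 - γ + A)⁻¹`. -/
def resolventNat (n : ℕ) : H →L[ℂ] H :=
  h.resolvent (n + 1) (by linarith [Nat.cast_nonneg (α := ℝ) n])

/-- The Yosida approximation `γ + s - s² (s - γ + A)⁻¹`, `s = n + 1`, of `A`: it is `γ` plus the
usual Yosida approximation of the accretive relation `A - γ`. -/
def yosida (n : ℕ) : H →L[ℂ] H :=
  ((n + 1 + γ : ℝ) : ℂ) • ContinuousLinearMap.id ℂ H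
    - (((n + 1 : ℝ) ^ 2 : ℝ) : ℂ) • h.resolventNat n

/-- The semigroup generated by minus the Yosida approximation. -/
def yosidaExp (n : ℕ) (t : ℝ) : H →L[ℂ] H :=
  NormedSpace.exp (t • -h.yosida n)

include h

theorem mul_norm_resolventNat_le (n : ℕ) (f : H) : (n + 1) * ‖h.resolventNat n f‖ ≤ ‖f‖ :=
  h.mul_norm_resolvent_le _ _ f

theorem yosida_apply (n : ℕ) (x : H) : h.yosida n x
    = ((n + 1 + γ : ℝ) : ℂ) • x - (((n + 1 : ℝ) ^ 2 : ℝ) : ℂ) • h.resolventNat n x := rfl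

/-- The Yosida approximations inherit the accretivity constant `γ`, as `s (s - γ + A)⁻¹` is a
contraction. -/
theorem yosida_accretive (n : ℕ) (x : H) : γ * ‖x‖ ^ 2 ≤ (inner ℂ x (h.yosida n x)).re := by
  have h1 := h.mul_norm_resolventNat_le n x
  have h2 : (inner ℂ x (h.resolventNat n x)).re ≤ ‖x‖ * ‖h.resolventNat n x‖ :=
    re_inner_le_norm (𝕜 := ℂ) _ _
  have h3 : (inner ℂ x x).re = ‖x‖ ^ 2 := inner_self_eq_norm_sq (𝕜 := ℂ) x
  rw [h.yosida_apply, inner_sub_right, inner_smul_right, inner_smul_right, Complex.sub_re,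
    Complex.re_ofReal_mul, Complex.re_ofReal_mul, h3]
  have hn : (0 : ℝ) < n + 1 := by positivity
  have h4 : (n + 1 : ℝ) ^ 2 * (inner ℂ x (h.resolventNat n x)).re ≤ (n + 1) * ‖x‖ ^ 2 := by
    calc _ ≤ (n + 1 : ℝ) ^ 2 * (‖x‖ * ‖h.resolventNat n x‖) := by gcongr
      _ = (n + 1) * ‖x‖ * ((n + 1) * ‖h.resolventNat n x‖) := by ring
      _ ≤ (n + 1) * ‖x‖ * ‖x‖ := by gcongr
      _ = _ := by ring
  linarith

theorem smul_resolventNat_of_mem (n : ℕ) {x y : H} (hx : (x, y) ∈ A) :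
    ((n + 1 : ℝ) : ℂ) • h.resolventNat n x = x - h.resolventNat n (y - (γ : ℂ) • x) := by
  have h1 : h.resolventNat n (y + ((n + 1 - γ : ℝ) : ℂ) • x) = x :=
    h.resolvent_apply_of_mem _ hx
  have e : y + ((n + 1 - γ : ℝ) : ℂ) • x = (y - (γ : ℂ) • x) + ((n + 1 : ℝ) : ℂ) • x := by
    push_cast; module
  rw [e, map_add, map_smul] at h1
  exact eq_sub_of_add_eq' h1

variable [CompleteSpace H]

theorem tendsto_smul_resolventNat (x : H) :
    Tendsto (fun n : ℕ => ((n + 1 : ℝ) : ℂ) • h.resolventNat n x) atTop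
      (𝓝 ((relDomClosure A).starProjection x)) := by
  have key : ∀ x ∈ relDomClosure A,
      Tendsto (fun n : ℕ => ((n + 1 : ℝ) : ℂ) • h.resolventNat n x) atTop (𝓝 x) := by
    have hcl := isClosed_setOf_tendstoUniformlyOn (l := atTop) (S := {()}) (M := 1)
      (F := fun (n : ℕ) (_ : Unit) => ((n + 1 : ℝ) : ℂ) • h.resolventNat n)
      (G := fun _ => ContinuousLinearMap.id ℂ H)
      (fun n _ _ x => by
        rw [smul_apply, norm_smul, Complex.norm_real, one_mul,
          Real.norm_eq_abs, abs_of_nonneg (by positivity)]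
        exact h.mul_norm_resolventNat_le n x)
      (fun _ _ x => by simp)
    have e : ∀ x, (TendstoUniformlyOn
        (fun (n : ℕ) (_ : Unit) => (((n + 1 : ℝ) : ℂ) • h.resolventNat n) x)
        (fun _ => ContinuousLinearMap.id ℂ H x) atTop {()}) ↔
        Tendsto (fun n : ℕ => ((n + 1 : ℝ) : ℂ) • h.resolventNat n x) atTop (𝓝 x) := by
      intro x
      rw [tendstoUniformlyOn_singleton_iff_tendsto]
      rfl
    simp only [e] at hcl
    refine fun x hx => relDomClosure_induction hcl (fun x y hxy => ?_) hx
    have h1 : Tendsto (fun n : ℕ => h.resolventNat n (y - (γ : ℂ) • x)) atTop (𝓝 0) := by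
      refine squeeze_zero_norm (a := fun n : ℕ => ‖y - (γ : ℂ) • x‖ * (1 / ((n : ℝ) + 1)))
        (fun n => ?_) ?_
      · rw [mul_one_div, le_div_iff₀ (by positivity), mul_comm]
        exact h.mul_norm_resolventNat_le n _
      · simpa using tendsto_one_div_add_atTop_nhds_zero_nat.const_mul ‖y - (γ : ℂ) • x‖
    have h2 := h1.const_sub x
    rw [sub_zero] at h2
    exact h2.congr fun n => (h.smul_resolventNat_of_mem n hxy).symm
  refine (key _ (Submodule.starProjection_apply_mem _ x)).congr fun n => ?_
  have : h.resolventNat n (x - (relDomClosure A).starProjection x) = 0 :=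
    h.resolvent_eq_zero _ (Submodule.sub_starProjection_mem_orthogonal x)
  rw [map_sub, sub_eq_zero] at this
  rw [this]

theorem tendsto_yosida {x y : H} (hx : (x, y) ∈ A) :
    Tendsto (fun n => h.yosida n x) atTop (𝓝 ((relDomClosure A).starProjection y)) := by
  have h1 := (h.tendsto_smul_resolventNat (y - (γ : ℂ) • x)).const_add ((γ : ℂ) • x)
  rw [map_sub, map_smul, Submodule.starProjection_eq_self_iff.2 (fst_mem_relDomClosure hx),
    add_sub_cancel] at h1
  refine h1.congr fun n => ?_
  have h2 : (((n + 1 : ℝ) ^ 2 : ℝ) : ℂ) • h.resolventNat n x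
      = ((n + 1 : ℝ) : ℂ) • (x - h.resolventNat n (y - (γ : ℂ) • x)) := by
    rw [← h.smul_resolventNat_of_mem n hx, smul_smul]
    congr 1; push_cast; ring
  rw [h.yosida_apply, h2]
  push_cast
  module

theorem commute_resolventNat_starProjection (n : ℕ) :
    Commute (relDomClosure A).starProjection (h.resolventNat n) := by
  ext x
  have h1 : h.resolventNat n (x - (relDomClosure A).starProjection x) = 0 :=
    h.resolvent_eq_zero _ (Submodule.sub_starProjection_mem_orthogonal x)
  rw [map_sub, sub_eq_zero] at h1
  have h2 : h.resolventNat n x ∈ relDomClosure A :=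
    fst_mem_relDomClosure (h.resolvent_mem _ _ _)
  change (relDomClosure A).starProjection (h.resolventNat n x)
    = h.resolventNat n ((relDomClosure A).starProjection x)
  rw [← h1, Submodule.starProjection_eq_self_iff.2 h2]

omit [CompleteSpace H] in
theorem commute_yosida_of_commute {B : H →L[ℂ] H} {n : ℕ} (hB : Commute B (h.resolventNat n)) :
    Commute B (h.yosida n) :=
  ((Commute.one_right B).smul_right _).sub_right (hB.smul_right _)

theorem commute_yosidaExp_of_commute {B : H →L[ℂ] H} {n : ℕ}
    (hB : Commute B (h.resolventNat n)) (t : ℝ) : Commute B (h.yosidaExp n t) :=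
  ((h.commute_yosida_of_commute hB).neg_right.smul_right t).exp_right

omit [CompleteSpace H] in
theorem yosidaExp_zero (n : ℕ) : h.yosidaExp n 0 = 1 := by
  rw [yosidaExp, zero_smul, NormedSpace.exp_zero]

theorem yosidaExp_add (n : ℕ) (s t : ℝ) :
    h.yosidaExp n (s + t) = h.yosidaExp n s * h.yosidaExp n t := by
  let _ : NormedAlgebra ℚ (H →L[ℂ] H) := NormedAlgebra.restrictScalars ℚ ℂ _
  rw [yosidaExp, add_smul]
  exact NormedSpace.exp_add_of_commute (((Commute.refl _).smul_left s).smul_right t)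

theorem yosidaExp_yosida (n : ℕ) (t : ℝ) (x : H) :
    h.yosidaExp n t (h.yosida n x) = h.yosida n (h.yosidaExp n t x) :=
  (DFunLike.congr_fun (((Commute.refl (h.yosida n)).neg_right.smul_right t).exp_right.eq) x).symm

theorem hasDerivAt_yosidaExp (n : ℕ) (x : H) (t : ℝ) :
    HasDerivAt (fun s => h.yosidaExp n s x) (-h.yosida n (h.yosidaExp n t x)) t :=
  ((ContinuousLinearMap.apply ℂ H x).restrictScalars ℝ).hasFDerivAt.comp_hasDerivAt t
    (hasDerivAt_exp_smul_const' (𝕂 := ℝ) (-h.yosida n) t)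

theorem norm_yosidaExp_le (n : ℕ) {t : ℝ} (ht : 0 ≤ t) (x : H) :
    ‖h.yosidaExp n t x‖ ≤ Real.exp (-γ * t) * ‖x‖ := by
  have := norm_le_exp_mul_of_re_inner_deriv_le (γ := γ) (b := t)
    (fun s _ => (h.hasDerivAt_yosidaExp n x s).continuousAt.continuousWithinAt)
    (fun s _ => (h.hasDerivAt_yosidaExp n x s).hasDerivWithinAt)
    (fun s _ => by
      rw [inner_neg_right, Complex.neg_re]
      linarith [h.yosida_accretive n (h.yosidaExp n s x)]) t ⟨ht, le_rfl⟩
  simpa [h.yosidaExp_zero] using this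

theorem norm_yosidaExp_le_of_le (n : ℕ) {t b : ℝ} (ht : 0 ≤ t) (hb : t ≤ b) (x : H) :
    ‖h.yosidaExp n t x‖ ≤ Real.exp (|γ| * b) * ‖x‖ := by
  refine (h.norm_yosidaExp_le n ht x).trans ?_
  gcongr
  exact neg_le_abs γ

/-- The difference of two approximating orbits solves an inhomogeneous equation whose forcing term is
`exp(-t A_m) (A_n x - A_m x)`, because the Yosida approximations commute. -/
theorem norm_yosidaExp_sub_le (m n : ℕ) (x : H) {t b : ℝ} (ht : t ∈ Set.Icc 0 b) :
    ‖h.yosidaExp n t x - h.yosidaExp m t x‖ ≤ Real.exp (|γ| * b) * ‖h.yosida n x - h.yosida m x‖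
      * Real.exp ((1 + 2 * |γ|) * b / 2) := by
  refine norm_le_mul_exp_of_re_inner_deriv_le (γ := γ) (b := b) (by positivity)
    (u := fun s => h.yosidaExp n s x - h.yosidaExp m s x)
    (fun s _ => ((h.hasDerivAt_yosidaExp n x s).sub
      (h.hasDerivAt_yosidaExp m x s)).continuousAt.continuousWithinAt)
    (fun s _ => ((h.hasDerivAt_yosidaExp n x s).sub
      (h.hasDerivAt_yosidaExp m x s)).hasDerivWithinAt)
    (by simp [h.yosidaExp_zero]) (fun s hs => ?_) t ht
  set w := h.yosidaExp n s x - h.yosidaExp m s x with hw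
  set g := h.yosidaExp m s (h.yosida n x - h.yosida m x) with hg
  have hcomm : h.yosida n (h.yosidaExp m s x) = h.yosidaExp m s (h.yosida n x) :=
    DFunLike.congr_fun (h.commute_yosidaExp_of_commute
      (h.commute_yosida_of_commute (h.commute_resolvent _ _ _ _)).symm s).eq x
  have e : -h.yosida n (h.yosidaExp n s x) - -h.yosida m (h.yosidaExp m s x)
      = -h.yosida n w - g := by
    rw [hw, hg, map_sub, map_sub, hcomm, h.yosidaExp_yosida m]
    abel
  rw [e, inner_sub_right, inner_neg_right, Complex.sub_re, Complex.neg_re]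
  have h1 := h.yosida_accretive n w
  have h2 : |(inner ℂ w g).re| ≤ ‖w‖ * ‖g‖ :=
    (Complex.abs_re_le_norm _).trans (norm_inner_le_norm _ _)
  have h3 := mul_le_mul_of_nonneg_left
    (h.norm_yosidaExp_le_of_le m hs.1 hs.2.le (h.yosida n x - h.yosida m x)) (norm_nonneg w)
  have h4 := neg_abs_le (inner ℂ w g).re
  linarith

theorem uniformCauchySeqOn_yosidaExp {x : H} (hx : x ∈ relDomClosure A) (b : ℝ≥0) :
    UniformCauchySeqOn (fun n (t : ℝ≥0) => h.yosidaExp n t x) atTop (Set.Iic b) := by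
  have hcl := isClosed_setOf_tendstoUniformlyOn (l := atTop ×ˢ atTop) (S := Set.Iic b)
    (M := 2 * Real.exp (|γ| * b))
    (F := fun (p : ℕ × ℕ) (t : ℝ≥0) => -h.yosidaExp p.1 t + h.yosidaExp p.2 t) (G := 0)
    (fun p t ht x => by
      have h1 := h.norm_yosidaExp_le_of_le p.1 t.coe_nonneg (NNReal.coe_le_coe.2 ht) x
      have h2 := h.norm_yosidaExp_le_of_le p.2 t.coe_nonneg (NNReal.coe_le_coe.2 ht) x
      rw [add_apply, neg_apply]
      refine (norm_add_le _ _).trans ?_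
      rw [norm_neg]
      linarith)
    (fun t _ x => by
      rw [Pi.zero_apply, zero_apply, norm_zero]
      positivity)
  rw [SeminormedAddGroup.uniformCauchySeqOn_iff_tendstoUniformlyOn_zero]
  refine relDomClosure_induction (p := fun x => TendstoUniformlyOn
    (fun (p : ℕ × ℕ) (t : ℝ≥0) => -h.yosidaExp p.1 t x + h.yosidaExp p.2 t x) 0
    (atTop ×ˢ atTop) (Set.Iic b)) hcl (fun x y hxy => ?_) hx
  rw [SeminormedAddGroup.tendstoUniformlyOn_zero]
  intro ε hε
  set C := Real.exp (|γ| * b) * Real.exp ((1 + 2 * |γ|) * b / 2) with hC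
  have hC0 : 0 < C := by positivity
  have h1 : Tendsto (fun p : ℕ × ℕ => C * ‖h.yosida p.2 x - h.yosida p.1 x‖)
      (atTop ×ˢ atTop) (𝓝 0) := by
    have := ((((h.tendsto_yosida hxy).comp tendsto_snd).sub
      ((h.tendsto_yosida hxy).comp tendsto_fst)).norm.const_mul C)
    simpa using this
  filter_upwards [h1.eventually (gt_mem_nhds hε)] with p hp t ht
  have h2 := h.norm_yosidaExp_sub_le p.1 p.2 x (t := t) (b := b) ⟨t.coe_nonneg, ht⟩
  rw [neg_add_eq_sub]
  refine h2.trans_lt ?_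
  rw [hC] at hp
  linarith

theorem exists_tendstoUniformlyOn_yosidaExp : ∃ T : ℝ≥0 → H →L[ℂ] H, ∀ (x : H) (b : ℝ≥0),
    TendstoUniformlyOn (fun n (t : ℝ≥0) => h.yosidaExp n t ((relDomClosure A).starProjection x))
      (fun t => T t x) atTop (Set.Iic b) := by
  have hc := fun (x : H) (b : ℝ≥0) => h.uniformCauchySeqOn_yosidaExp
    (Submodule.starProjection_apply_mem (relDomClosure A) x) b
  have hex : ∀ (t : ℝ≥0) (x : H), ∃ y, Tendsto
      (fun n => h.yosidaExp n t ((relDomClosure A).starProjection x)) atTop (𝓝 y) := fun t x =>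
    cauchySeq_tendsto_of_complete ((hc x t).cauchySeq (Set.mem_Iic.2 le_rfl))
  choose T hT using hex
  exact ⟨fun t => continuousLinearMapOfTendsto
    (fun n => h.yosidaExp n t ∘L (relDomClosure A).starProjection) (tendsto_pi_nhds.2 (hT t)),
    fun x b => (hc x b).tendstoUniformlyOn_of_tendsto fun t _ => hT t x⟩

/-- Minus a maximal quasi-accretive relation generates a degenerate strongly continuous
semigroup, the strong limit of `exp(-t Aₙ) P`, where the `Aₙ` are the Yosida approximations and `P`
is the orthogonal projection onto the closure of the domain. -/
theorem exists_isDegenerateSemigroupGeneratedBy :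
    ∃ T : ℝ≥0 → H →L[ℂ] H, IsDegenerateSemigroupGeneratedBy T (negRel A) := by
  obtain ⟨T, hT⟩ := h.exists_tendstoUniformlyOn_yosidaExp
  set P := (relDomClosure A).starProjection with hP
  have hPmem : ∀ x ∈ relDomClosure A, P x = x := fun x hx =>
    (Submodule.starProjection_eq_self_iff (K := relDomClosure A)).2 hx
  have hPP : ∀ x, P (P x) = P x := fun x => hPmem _ (Submodule.starProjection_apply_mem _ x)
  have hlim : ∀ (t : ℝ≥0) (x : H), Tendsto (fun n => h.yosidaExp n t (P x)) atTop
      (𝓝 (T t x)) := fun t x => (hT x t).tendsto_at (Set.mem_Iic.2 le_rfl)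
  have hcommP : ∀ (n : ℕ) (t : ℝ) (x : H), P (h.yosidaExp n t x) = h.yosidaExp n t (P x) :=
    fun n t x => DFunLike.congr_fun
      (h.commute_yosidaExp_of_commute (h.commute_resolventNat_starProjection n) t).eq x
  have hT0 : ∀ x, T 0 x = P x := fun x => by
    refine tendsto_nhds_unique (hlim 0 x) ?_
    simp [h.yosidaExp_zero]
  have hbound : ∀ (t : ℝ≥0) (x : H), ‖T t x‖ ≤ Real.exp (-γ * t) * ‖x‖ := fun t x => by
    refine le_of_tendsto (hlim t x).norm (Eventually.of_forall fun n => ?_)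
    exact (h.norm_yosidaExp_le n t.coe_nonneg _).trans (mul_le_mul_of_nonneg_left
      (Submodule.norm_starProjection_apply_le _ x) (Real.exp_pos _).le)
  have hcont : ∀ x, Tendsto (fun t => T t x) (𝓝 0) (𝓝 (T 0 x)) := fun x => by
    have h1 : ContinuousOn (fun t => T t x) (Set.Iic 1) :=
      (hT x 1).continuousOn (Eventually.of_forall fun n => by
        have : Continuous fun s : ℝ => h.yosidaExp n s (P x) :=
          continuous_iff_continuousAt.2 fun s => (h.hasDerivAt_yosidaExp n (P x) s).continuousAt
        exact (this.comp NNReal.continuous_coe).continuousOn).frequently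
    exact h1.continuousAt (Iic_mem_nhds zero_lt_one)
  have hsemi : IsDegenerateSemigroup T := by
    refine ⟨fun s t => ?_, fun x => (hcont x).mono_left nhdsWithin_le_nhds⟩
    ext x
    refine tendsto_nhds_unique (hlim (s + t) x) ?_
    -- `Sₙ(s) Sₙ(t) P x = Sₙ(s) P (Sₙ(t) P x - T(t) x) + Sₙ(s) P T(t) x`, with `Sₙ(s)` bounded
    have h1 : Tendsto (fun n => h.yosidaExp n s (P (h.yosidaExp n t (P x) - T t x))) atTop
        (𝓝 0) := by
      have h2 : Tendsto (fun n => Real.exp (-γ * s) * ‖h.yosidaExp n t (P x) - T t x‖) atTop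
          (𝓝 0) := by
        simpa using (((hlim t x).sub_const (T t x)).norm.const_mul (Real.exp (-γ * s)))
      refine squeeze_zero_norm (fun n => ?_) h2
      exact (h.norm_yosidaExp_le n s.coe_nonneg _).trans (mul_le_mul_of_nonneg_left
        (Submodule.norm_starProjection_apply_le _ _) (Real.exp_pos _).le)
    have h3 := h1.add (hlim s (T t x))
    rw [zero_add] at h3
    refine h3.congr fun n => ?_
    rw [map_sub, map_sub, sub_add_cancel, hcommP, hPP, NNReal.coe_add, h.yosidaExp_add]
    rfl
  -- `-A` is contained in the generator.
  have hle : A ≤ negRel (generatorRel T) := by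
    rintro ⟨x, y⟩ hxy
    have hx := hPmem x (fst_mem_relDomClosure hxy)
    refine ⟨⟨x, (hT0 x).trans hx⟩, -P y, P y - y, ?_, ?_, ?_⟩
    · rw [Metric.tendsto_nhds]
      intro ε hε
      have hev : ∀ᶠ b : ℝ≥0 in 𝓝 0, ∀ s ∈ Set.Iic b, ‖T s (P y) - P y‖ < ε / 4 := by
        have h1 := (hcont (P y)).sub_const (P y)
        rw [hT0, hPP, sub_self] at h1
        have h2 := h1.norm
        rw [norm_zero] at h2
        obtain ⟨c, hc, hcs⟩ := (nhds_bot_basis (α := ℝ≥0)).eventually_iff.1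
          (h2.eventually (gt_mem_nhds (show 0 < ε / 4 by positivity)))
        filter_upwards [gt_mem_nhds (bot_lt_iff_ne_bot.2 hc.ne')] with b hb s hs
        exact hcs (lt_of_le_of_lt hs hb)
      filter_upwards [hev.filter_mono nhdsWithin_le_nhds, self_mem_nhdsWithin] with b hb hb0
      have hb0' : (0 : ℝ) < b := hb0
      have hy := h.tendsto_yosida hxy
      rw [← hP] at hy
      have e1 := ((hy.sub_const (P y)).norm.const_mul (Real.exp (|γ| * b)))
      rw [sub_self, norm_zero, mul_zero] at e1
      have e2 := Metric.tendstoUniformlyOn_iff.1 (hT (P y) b) (ε / 4) (by positivity)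
      have hn : ∀ᶠ n in atTop, ‖h.yosidaExp n b (P x) - x + (b : ℝ) • P y‖ ≤ 3 * ε / 4 * b := by
        filter_upwards [e1.eventually (gt_mem_nhds (show 0 < ε / 4 by positivity)), e2]
          with n h1 h2
        have hmv := norm_image_sub_le_of_norm_deriv_le_segment' (a := 0) (b := b)
          (f := fun s : ℝ => h.yosidaExp n s x + s • P y)
          (f' := fun s => -h.yosida n (h.yosidaExp n s x) + (1 : ℝ) • P y) (C := 3 * ε / 4)
          (fun s _ => ((h.hasDerivAt_yosidaExp n x s).add
            ((hasDerivAt_id s).smul_const (P y))).hasDerivWithinAt) (fun s hs => ?_) b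
          ⟨b.coe_nonneg, le_rfl⟩
        · rw [hx]
          simpa [h.yosidaExp_zero, sub_add_eq_add_sub] using hmv
        · obtain ⟨s, rfl⟩ : ∃ r : ℝ≥0, (r : ℝ) = s := ⟨⟨s, hs.1⟩, rfl⟩
          have hsb : s ≤ b := hs.2.le
          have h3 := h.norm_yosidaExp_le_of_le n s.coe_nonneg hsb (h.yosida n x - P y)
          have h4 := h2 s hsb
          have h5 := hb s hsb
          rw [dist_eq_norm, hPP] at h4
          rw [← h.yosidaExp_yosida, one_smul, ← norm_neg]
          calc _ = ‖h.yosidaExp n s (h.yosida n x - P y)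
                - (T s (P y) - h.yosidaExp n s (P y)) + (T s (P y) - P y)‖ := by
                congr 1; rw [map_sub]; abel
            _ ≤ ε / 4 + ε / 4 + ε / 4 := by
                refine (norm_add_le _ _).trans (add_le_add ((norm_sub_le _ _).trans ?_) h5.le)
                exact add_le_add (h3.trans h1.le) h4.le
            _ = 3 * ε / 4 := by ring
      have hfin := le_of_tendsto (((hlim b x).sub_const x).add_const ((b : ℝ) • P y)).norm hn
      have e3 : (((b : ℝ) : ℂ)⁻¹) • (T b x - x) - -P y
          = (((b : ℝ) : ℂ)⁻¹) • (T b x - x + (b : ℝ) • P y) := by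
        have hbne : ((b : ℝ) : ℂ) ≠ 0 := Complex.ofReal_ne_zero.2 hb0'.ne'
        rw [smul_add, ← Complex.coe_smul, inv_smul_smul₀ hbne, sub_neg_eq_add]
      change dist ((((b : ℝ) : ℂ)⁻¹) • (T b x - x)) (-P y) < ε
      rw [dist_eq_norm, e3, norm_smul, norm_inv, Complex.norm_real, Real.norm_eq_abs,
        abs_of_pos hb0', inv_mul_lt_iff₀ hb0']
      nlinarith
    · change T 0 (P y - y) = 0
      rw [map_sub, hT0, hT0, hPP, sub_self]
    · change -y = -P y + (P y - y)
      abel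
  -- The generator is quasi-accretive, hence it is not larger than `-A`.
  have hacc : ∀ p ∈ negRel (generatorRel T), γ * ‖p.1‖ ^ 2 ≤ (inner ℂ p.1 p.2).re := by
    rintro ⟨x, y⟩ ⟨hx, z, k, hz, hk, e⟩
    have hx0 := hsemi.zero_apply_of_mem_range hx
    have hk' : T 0 k = 0 := hk
    have e' : -y = z + k := e
    change T 0 x = x at hx0
    change Tendsto (fun t : ℝ≥0 => (((t : ℝ) : ℂ)⁻¹) • (T t x - x)) (𝓝[>] 0) (𝓝 z) at hz
    rw [hT0] at hx0 hk'
    have hxk : inner ℂ x k = 0 :=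
      (Submodule.mem_orthogonal _ _).1
        ((Submodule.starProjection_apply_eq_zero_iff (relDomClosure A)).1 hk') _
        (Submodule.starProjection_eq_self_iff.1 hx0)
    have h1 : (inner ℂ x z).re ≤ -γ * ‖x‖ ^ 2 := by
      have h2 := Complex.continuous_re.continuousAt.tendsto.comp
        ((tendsto_const_nhds (x := x)).inner hz (𝕜 := ℂ))
      have h3 : Tendsto (fun t : ℝ≥0 => (t : ℝ)⁻¹ * (Real.exp (-γ * t) - 1) * ‖x‖ ^ 2)
          (𝓝[>] 0) (𝓝 (-γ * ‖x‖ ^ 2)) := by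
        have h4 : HasDerivAt (fun t : ℝ => Real.exp (-γ * t)) (-γ) 0 := by
          simpa using ((hasDerivAt_id (0 : ℝ)).const_mul (-γ)).exp
        have h5 : Tendsto (fun t : ℝ≥0 => (t : ℝ)) (𝓝[>] 0) (𝓝[≠] 0) := by
          refine tendsto_nhdsWithin_iff.2 ⟨?_, ?_⟩
          · exact (NNReal.continuous_coe.tendsto 0).mono_left nhdsWithin_le_nhds
          · filter_upwards [self_mem_nhdsWithin] with t ht
            exact (NNReal.coe_pos.2 ht).ne'
        have h6 := ((hasDerivAt_iff_tendsto_slope_zero.1 h4).comp h5).mul_const (‖x‖ ^ 2)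
        simpa [Function.comp_def] using h6
      refine le_of_tendsto_of_tendsto h2 h3 ?_
      filter_upwards [self_mem_nhdsWithin] with t ht
      have ht' : (0 : ℝ) < t := ht
      have h7 : (inner ℂ x (T t x)).re ≤ Real.exp (-γ * t) * ‖x‖ ^ 2 := by
        have h8 : (inner ℂ x (T t x)).re ≤ ‖x‖ * ‖T t x‖ := re_inner_le_norm (𝕜 := ℂ) _ _
        nlinarith [hbound t x, norm_nonneg x]
      have h9 : (inner ℂ x x).re = ‖x‖ ^ 2 := inner_self_eq_norm_sq (𝕜 := ℂ) x
      simp only [Function.comp_apply]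
      rw [inner_smul_right, ← Complex.ofReal_inv, Complex.re_ofReal_mul, inner_sub_right,
        Complex.sub_re, h9, mul_assoc]
      gcongr
      linarith
    have e'' : y = -(z + k) := by rw [← e', neg_neg]
    change γ * ‖x‖ ^ 2 ≤ (inner ℂ x y).re
    rw [e'', inner_neg_right, inner_add_right, hxk, add_zero, Complex.neg_re]
    linarith
  refine ⟨T, hsemi, ?_⟩
  have := h.eq_of_le hle hacc
  ext ⟨x, y⟩
  rw [mem_negRel, this, mem_negRel, neg_neg]

theorem existsUnique_isDegenerateSemigroupGeneratedBy :
    ∃! T : ℝ≥0 → H →L[ℂ] H, IsDegenerateSemigroupGeneratedBy T (negRel A) := by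
  obtain ⟨T, hT⟩ := h.exists_isDegenerateSemigroupGeneratedBy
  exact ⟨T, hT, fun S hS => hS.eq_of_isMaxQuasiAccretive h hT⟩

end IsMaxQuasiAccretive

/-! ### The relation associated with a quasi-sectorial form -/

section FormRel

theorem exists_norm_apply₂_le {V : Type*} [SeminormedAddCommGroup V] [NormedSpace ℂ V]
    (B : V →L[ℂ] V →L⋆[ℂ] ℂ) : ∃ C, 0 ≤ C ∧ ∀ u v, ‖B u v‖ ≤ C * ‖u‖ * ‖v‖ :=
  ⟨‖B‖, norm_nonneg B, B.le_opNorm₂⟩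

theorem continuous_apply_self {V : Type*} [SeminormedAddCommGroup V] [NormedSpace ℂ V]
    (B : V →L[ℂ] V →L⋆[ℂ] ℂ) : Continuous fun u => B u u := by
  obtain ⟨C, -, hC⟩ := exists_norm_apply₂_le B
  rw [continuous_iff_continuousAt]
  intro u₀
  rw [ContinuousAt, tendsto_iff_norm_sub_tendsto_zero]
  have hlim : Tendsto (fun u => C * ‖u - u₀‖ * ‖u‖ + C * ‖u₀‖ * ‖u - u₀‖) (𝓝 u₀) (𝓝 0) := by
    have : Continuous fun u => C * ‖u - u₀‖ * ‖u‖ + C * ‖u₀‖ * ‖u - u₀‖ := by fun_prop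
    simpa using this.tendsto u₀
  refine squeeze_zero (fun u => norm_nonneg _) (fun u => ?_) hlim
  have e : B u u - B u₀ u₀ = B (u - u₀) u + B u₀ (u - u₀) := by
    rw [map_sub, map_sub, sub_apply]; ring
  rw [e]
  exact (norm_add_le _ _).trans (add_le_add (hC _ _) (hC _ _))

variable {H : Type*} [NormedAddCommGroup H] [InnerProductSpace ℂ H]
  {E : Type*} [AddCommGroup E] [Module ℂ E] {a : SesqForm E} {j : E →ₗ[ℂ] H} {γ : ℝ}
  (h : IsQuasiSectorial a j γ)

theorem continuous_aExt_self : Continuous fun u : FormCompletion h => aExt h u u :=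
  continuous_apply_self (aExt h)

theorem exists_norm_aExt_le :
    ∃ C, 0 ≤ C ∧ ∀ u v : FormCompletion h, ‖aExt h u v‖ ≤ C * ‖u‖ * ‖v‖ :=
  exists_norm_apply₂_le (aExt h)

theorem formCompletion_induction {p : FormCompletion h → Prop} (hp : IsClosed {u | p u})
    (hE : ∀ x : E, p (formEmb h (FormDomain.of h x))) (u : FormCompletion h) : p u :=
  UniformSpace.Completion.induction_on u hp fun x => hE x

variable [CompleteSpace H]

/-- The form `ã(u, v) + (1 - γ) ⟨j̃ u, j̃ v⟩` is coercive with constant `1`. -/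
theorem norm_sq_formCompletion (u : FormCompletion h) :
    ‖u‖ ^ 2 = (aExt h u u).re + (1 - γ) * ‖jExt h u‖ ^ 2 := by
  refine formCompletion_induction h
    (p := fun u => ‖u‖ ^ 2 = (aExt h u u).re + (1 - γ) * ‖jExt h u‖ ^ 2)
    (isClosed_eq (continuous_norm.pow 2)
    ((Complex.continuous_re.comp (continuous_aExt_self h)).add
      (((jExt h).continuous.norm.pow 2).const_mul (1 - γ)))) (fun x => ?_) u
  rw [jExt_formEmb, aExt_formEmb]
  exact (congrArg (· ^ 2) (UniformSpace.Completion.norm_coe (FormDomain.of h x))).trans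
    (FormDomain.norm_sq_eq h _)

theorem norm_jExt_le (u : FormCompletion h) : ‖jExt h u‖ ≤ ‖u‖ := by
  refine formCompletion_induction h
    (isClosed_le (jExt h).continuous.norm continuous_norm) (fun x => ?_) u
  rw [jExt_formEmb]
  have h1 := FormDomain.norm_jLin_le h (FormDomain.of h x)
  rw [one_mul] at h1
  exact h1.trans (UniformSpace.Completion.norm_coe (FormDomain.of h x)).ge

omit [CompleteSpace H] in
theorem re_inner_self_eq (x : H) :
    (inner ℂ x x).re = ‖x‖ ^ 2 := inner_self_eq_norm_sq (𝕜 := ℂ) x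

/-- The Lax-Milgram theorem for the coercive form `ã(u, v) + (s - γ) ⟨j̃ u, j̃ v⟩`. -/
theorem exists_forall_aExt_add_eq {s : ℝ} (hs : 1 ≤ s) (f : H) : ∃ u : FormCompletion h, ∀ v,
    aExt h u v + ((s - γ : ℝ) : ℂ) * inner ℂ (jExt h v) (jExt h u) = inner ℂ (jExt h v) f := by
  let G := InnerProductSpace.continuousLinearMapOfBilin (aExt h).flip
  let L : FormCompletion h →L[ℂ] FormCompletion h :=
    G.adjoint + ((s - γ : ℝ) : ℂ) • ((jExt h).adjoint ∘L jExt h)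
  have hL : ∀ u v, inner ℂ v (L u)
      = aExt h u v + ((s - γ : ℝ) : ℂ) * inner ℂ (jExt h v) (jExt h u) := by
    intro u v
    change inner ℂ v (G.adjoint u + ((s - γ : ℝ) : ℂ) • (jExt h).adjoint (jExt h u)) = _
    rw [inner_add_right, inner_smul_right, ContinuousLinearMap.adjoint_inner_right,
      ContinuousLinearMap.adjoint_inner_right, InnerProductSpace.continuousLinearMapOfBilin_apply,
      ContinuousLinearMap.flip_apply]
  have hunit : IsUnit L := by
    refine L.isUnit_of_forall_le_norm_inner_map (c := 1) one_pos fun u => ?_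
    rw [NNReal.coe_one, mul_one, ← norm_inner_symm]
    refine le_trans ?_ (Complex.re_le_norm _)
    rw [hL, Complex.add_re, Complex.re_ofReal_mul, re_inner_self_eq, norm_sq_formCompletion]
    nlinarith [sq_nonneg ‖jExt h u‖]
  obtain ⟨u, hu⟩ := (ContinuousLinearMap.isUnit_iff_bijective.1 hunit).2 ((jExt h).adjoint f)
  exact ⟨u, fun v => by rw [← hL, hu, ContinuousLinearMap.adjoint_inner_right]⟩

theorem mem_formRel_of_forall {s : ℝ} {f : H} {u : FormCompletion h} (hu : ∀ v,
    aExt h u v + ((s - γ : ℝ) : ℂ) * inner ℂ (jExt h v) (jExt h u) = inner ℂ (jExt h v) f) :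
    (jExt h u, f - ((s - γ : ℝ) : ℂ) • jExt h u) ∈ formRel h :=
  ⟨u, rfl, fun v => by rw [inner_sub_right, inner_smul_right, ← hu v, add_sub_cancel_right]⟩

theorem isMaxQuasiAccretive_formRel : IsMaxQuasiAccretive (formRel h) γ where
  accretive := by
    rintro ⟨x, y⟩ ⟨u, rfl, hu⟩
    rw [← hu u]
    nlinarith [norm_sq_formCompletion h u, norm_jExt_le h u, norm_nonneg (jExt h u)]
  surjective s hs f := by
    obtain ⟨u, hu⟩ := exists_forall_aExt_add_eq h hs f
    exact ⟨_, mem_formRel_of_forall h hu⟩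

/-- The domain of the associated relation is dense in the range of `j̃`, so its closure is the closure
of the range of `j`. -/
theorem jExt_mem_relDomClosure (u : FormCompletion h) :
    jExt h u ∈ relDomClosure (formRel h) := by
  rw [← Submodule.orthogonal_orthogonal (relDomClosure (formRel h)), Submodule.mem_orthogonal']
  intro y hy
  -- `(0, y)` in the relation comes from some `v` with `j̃ v = 0`, and then `‖v‖² = Re ã(v, v) = 0`.
  obtain ⟨v, hv0, hv⟩ := (isMaxQuasiAccretive_formRel h).zero_mem_iff.2 hy
  have hv0' : jExt h v = 0 := hv0
  have h1 : ‖v‖ ^ 2 = 0 := by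
    rw [norm_sq_formCompletion, hv, hv0']
    simp
  have h2 : v = 0 := by simpa using h1
  have h3 := hv u
  rw [h2] at h3
  simpa using h3.symm

theorem relDomClosure_formRel_le {X : Submodule ℂ H} (hX : IsClosed (X : Set H))
    (hj : ∀ x, j x ∈ X) : relDomClosure (formRel h) ≤ X := by
  refine fun x hx => relDomClosure_induction (p := (· ∈ X)) hX ?_ hx
  rintro _ _ ⟨u, rfl, -⟩
  refine formCompletion_induction h (hX.preimage (jExt h).continuous) (fun x => ?_) u
  exact (jExt_formEmb h x).symm ▸ hj x

end FormRel

/-! ### Convergence of forms implies convergence of resolvents -/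

section FormConvergence

/-- A Cauchy-Schwarz inequality for sectorial forms, with weights. -/
theorem norm_le_of_norm_self_mul_le {V : Type*} [AddCommGroup V] [Module ℂ V]
    {d : SesqForm V} {c : ℝ} (hc : 0 < c) (hd : ∀ u, ‖d u u‖ * c ≤ (d u u).re) (x y : V) :
    ‖d x y‖ ≤ 2 / c ^ 2 * (d x x).re + (d y y).re / 2 := by
  have pol : ∀ x y : V, ‖d x y‖ * c ≤ (d x x).re + (d y y).re := by
    intro x y
    have e : 4 * d x y = d (x + y) (x + y) - d (x - y) (x - y)
        + Complex.I * d (x + Complex.I • y) (x + Complex.I • y)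
        - Complex.I * d (x - Complex.I • y) (x - Complex.I • y) := by
      simp only [map_add, map_sub, map_smul, LinearMap.add_apply, LinearMap.sub_apply,
        LinearMap.smul_apply, map_smulₛₗ, smul_eq_mul, Complex.conj_I]
      linear_combination (2 * d x y - 2 * d y x) * Complex.I_sq
    have e' : 4 * (d x x + d y y) = d (x + y) (x + y) + d (x - y) (x - y)
        + d (x + Complex.I • y) (x + Complex.I • y)
        + d (x - Complex.I • y) (x - Complex.I • y) := by
      simp only [map_add, map_sub, map_smul, LinearMap.add_apply, LinearMap.sub_apply,
        LinearMap.smul_apply, map_smulₛₗ, smul_eq_mul, Complex.conj_I]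
      linear_combination (2 * d y y) * Complex.I_sq
    have n : ‖4 * d x y‖ ≤ ‖d (x + y) (x + y)‖ + ‖d (x - y) (x - y)‖
        + ‖d (x + Complex.I • y) (x + Complex.I • y)‖
        + ‖d (x - Complex.I • y) (x - Complex.I • y)‖ := by
      rw [e]
      refine (norm_sub_le _ _).trans ?_
      rw [norm_mul, Complex.norm_I, one_mul]
      gcongr
      refine (norm_add_le _ _).trans ?_
      rw [norm_mul, Complex.norm_I, one_mul]
      gcongr
      exact norm_sub_le _ _
    have r := congrArg Complex.re e'
    simp only [Complex.add_re, Complex.mul_re, Complex.re_ofNat, Complex.im_ofNat, zero_mul,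
      sub_zero] at r
    rw [norm_mul, Complex.norm_ofNat] at n
    have n' := mul_le_mul_of_nonneg_right n hc.le
    linarith [hd (x + y), hd (x - y), hd (x + Complex.I • y), hd (x - Complex.I • y)]
  have h1 := pol (((2 / c : ℝ) : ℂ) • x) y
  have h2c : 0 < 2 / c := by positivity
  simp only [map_smul, LinearMap.smul_apply, map_smulₛₗ, smul_eq_mul, norm_mul,
    Complex.norm_real, Complex.conj_ofReal, Complex.re_ofReal_mul, Real.norm_eq_abs,
    abs_of_pos h2c] at h1
  have e1 : 2 / c * ‖d x y‖ * c = 2 * ‖d x y‖ := by field_simp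
  have e2 : 2 / c * (2 / c * (d x x).re) = 2 * (2 / c ^ 2 * (d x x).re) := by ring
  linarith

variable {H : Type*} [NormedAddCommGroup H] [InnerProductSpace ℂ H]
  {E : Type*} [AddCommGroup E] [Module ℂ E] {a : SesqForm E} {j : E →ₗ[ℂ] H} {γ : ℝ}
  (h : IsQuasiSectorial a j γ) {D : Submodule ℂ E} {b : SesqForm D} {θ : ℝ}
  (hθ : θ ∈ Set.Ico 0 (Real.pi / 2)) (hb : ∀ u : D, b u u - a u u ∈ closure (sectorSet θ))

theorem cos_pos_of_mem_Ico {θ : ℝ} (hθ : θ ∈ Set.Ico 0 (Real.pi / 2)) : 0 < Real.cos θ :=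
  Real.cos_pos_of_mem_Ioo ⟨by linarith [hθ.1, Real.pi_pos], hθ.2⟩

/-- The inclusion of `dom(b)` into `dom(a)`, for a form `b` on a subspace of `dom(a)` such that
`b - a` is sectorial. -/
def formInclusion : FormDomain (h.of_sub_mem hθ hb) →L[ℂ] FormDomain h :=
  LinearMap.mkContinuous ((FormDomain.of h).toLinearMap ∘ₗ D.subtype ∘ₗ
    (FormDomain.of (h.of_sub_mem hθ hb)).symm.toLinearMap) 1 fun x => by
      rw [one_mul]
      refine le_of_sq_le_sq ?_ (norm_nonneg _)
      rw [FormDomain.norm_sq_eq, FormDomain.norm_sq_eq]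
      have h1 := (mem_closure_sectorSet_iff hθ _).1
        (hb ((FormDomain.of (h.of_sub_mem hθ hb)).symm x))
      have h2 := (mul_nonneg (norm_nonneg _) (cos_pos_of_mem_Ico hθ).le).trans h1
      rw [Complex.sub_re] at h2
      exact add_le_add (sub_nonneg.1 h2) le_rfl

/-- The continuous extension of the inclusion of `dom(b)` into `dom(a)` to the completions; it need
not be injective. -/
def formInclusionExt : FormCompletion (h.of_sub_mem hθ hb) →L[ℂ] FormCompletion h :=
  (formEmb h ∘L formInclusion h hθ hb).extend (formEmb (h.of_sub_mem hθ hb))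

theorem formInclusionExt_formEmb (x : D) :
    formInclusionExt h hθ hb (formEmb _ (FormDomain.of _ x))
      = formEmb h (FormDomain.of h (x : E)) :=
  ContinuousLinearMap.extend_eq _ (denseRange_formEmb _) (isUniformInducing_formEmb _) _

theorem norm_mul_cos_le_re_aExt_sub (u : FormCompletion (h.of_sub_mem hθ hb)) :
    ‖aExt _ u u - aExt h (formInclusionExt h hθ hb u) (formInclusionExt h hθ hb u)‖ * Real.cos θ
      ≤ (aExt _ u u - aExt h (formInclusionExt h hθ hb u) (formInclusionExt h hθ hb u)).re := by
  have hc := (continuous_aExt_self (h.of_sub_mem hθ hb)).sub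
    ((continuous_aExt_self h).comp (formInclusionExt h hθ hb).continuous)
  have hcl := isClosed_le (hc.norm.mul_const (Real.cos θ)) (Complex.continuous_re.comp hc)
  refine formCompletion_induction _ (p := fun u => ‖aExt _ u u - aExt h
    (formInclusionExt h hθ hb u) (formInclusionExt h hθ hb u)‖ * Real.cos θ ≤ (aExt _ u u - aExt h
    (formInclusionExt h hθ hb u) (formInclusionExt h hθ hb u)).re) hcl (fun x => ?_) u
  rw [formInclusionExt_formEmb, aExt_formEmb, aExt_formEmb]
  exact (mem_closure_sectorSet_iff hθ _).1 (hb x)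

variable [CompleteSpace H]

theorem jExt_formInclusionExt (u : FormCompletion (h.of_sub_mem hθ hb)) :
    jExt h (formInclusionExt h hθ hb u) = jExt _ u := by
  refine formCompletion_induction _
    (p := fun u => jExt h (formInclusionExt h hθ hb u) = jExt _ u) (isClosed_eq
    ((jExt h).continuous.comp (formInclusionExt h hθ hb).continuous)
    (jExt (h.of_sub_mem hθ hb)).continuous) (fun x => ?_) u
  rw [formInclusionExt_formEmb, jExt_formEmb, jExt_formEmb]
  rfl

/-- A Céa-type estimate: the difference of the resolvents of the relations associated with `b` and
`a` is controlled by the distance of the solution `u` of the problem for `a` to any `w ∈ dom(b)`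
and by the error `b(w) - a(w)`. The constants do not depend on `b`. -/
theorem norm_resolvent_formRel_sub_le {C : ℝ} (hC0 : 0 ≤ C)
    (hC : ∀ x y : FormCompletion h, ‖aExt h x y‖ ≤ C * ‖x‖ * ‖y‖) {f : H}
    {u : FormCompletion h} (hu : ∀ v, aExt h u v + ((1 - γ : ℝ) : ℂ) * inner ℂ (jExt h v) (jExt h u)
      = inner ℂ (jExt h v) f)
    (w : D) :
    ‖(isMaxQuasiAccretive_formRel (h.of_sub_mem hθ hb)).resolvent 1 le_rfl f
      - (isMaxQuasiAccretive_formRel h).resolvent 1 le_rfl f‖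
      ≤ √(4 * (C + |1 - γ|) ^ 2 * ‖u - formEmb h (FormDomain.of h (w : E))‖ ^ 2
          + 8 / Real.cos θ ^ 2 * (b w w - a w w).re)
        + ‖u - formEmb h (FormDomain.of h (w : E))‖ := by
  set h' := h.of_sub_mem hθ hb with hh'
  set I := formInclusionExt h hθ hb with hI
  obtain ⟨u', hu'⟩ := exists_forall_aExt_add_eq h' le_rfl f
  have hR : (isMaxQuasiAccretive_formRel h).resolvent 1 le_rfl f = jExt h u :=
    (isMaxQuasiAccretive_formRel h).eq_of_mem one_pos
      ((isMaxQuasiAccretive_formRel h).resolvent_mem 1 le_rfl f) (mem_formRel_of_forall h hu)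
  have hR' : (isMaxQuasiAccretive_formRel h').resolvent 1 le_rfl f = jExt h' u' :=
    (isMaxQuasiAccretive_formRel h').eq_of_mem one_pos
      ((isMaxQuasiAccretive_formRel h').resolvent_mem 1 le_rfl f) (mem_formRel_of_forall h' hu')
  set W := formEmb h' (FormDomain.of h' w) with hW
  have hIW : I W = formEmb h (FormDomain.of h (w : E)) := formInclusionExt_formEmb h hθ hb w
  rw [hR, hR', ← hIW]
  set v := u' - W with hv
  set α := ‖u - I W‖ with hα
  set M := C + |1 - γ| with hM
  have hj : ∀ z, jExt h (I z) = jExt h' z := jExt_formInclusionExt h hθ hb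
  have hcos := cos_pos_of_mem_Ico hθ
  let d : SesqForm (FormCompletion h') := LinearMap.mk₂'ₛₗ (RingHom.id ℂ) (starRingEnd ℂ)
    (fun x y => aExt h' x y - aExt h (I x) (I y))
    (fun x x' y => by simp only [map_add, add_apply]; ring)
    (fun c x y => by simp only [map_smul, smul_apply, smul_eq_mul, RingHom.id_apply]; ring)
    (fun x y y' => by simp only [map_add]; ring)
    (fun c x y => by simp only [map_smulₛₗ, smul_eq_mul, RingHom.id_apply]; ring)
  have hd : ∀ x y, d x y = aExt h' x y - aExt h (I x) (I y) := fun _ _ => rfl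
  have hdW : d W W = b w w - a w w := by
    rw [hd, hIW, hW, aExt_formEmb, aExt_formEmb]
  have hdv : (d v v).re ≤ ‖v‖ ^ 2 := by
    have h1 := norm_sq_formCompletion h' v
    have h2 := norm_sq_formCompletion h (I v)
    rw [hj] at h2
    rw [hd, Complex.sub_re]
    nlinarith [sq_nonneg ‖I v‖]
  have hCS := norm_le_of_norm_self_mul_le hcos (d := d)
    (fun x => norm_mul_cos_le_re_aExt_sub h hθ hb x) W v
  rw [hdW] at hCS
  have hIv : ‖I v‖ ≤ ‖v‖ := by
    have h1 := norm_sq_formCompletion h' v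
    have h2 := norm_sq_formCompletion h (I v)
    have h3 : 0 ≤ (d v v).re := (mul_nonneg (norm_nonneg _) hcos.le).trans
      (norm_mul_cos_le_re_aExt_sub h hθ hb v)
    rw [hd, Complex.sub_re] at h3
    rw [hj] at h2
    exact le_of_sq_le_sq (by linarith) (norm_nonneg _)
  -- the error equation for `u' - w`
  have hE : ((‖v‖ ^ 2 : ℝ) : ℂ).re = (aExt h (u - I W) (I v)
      + ((1 - γ : ℝ) : ℂ) * inner ℂ (jExt h (I v)) (jExt h (u - I W)) - d W v).re := by
    have h1 : (aExt h' v v + ((1 - γ : ℝ) : ℂ) * inner ℂ (jExt h' v) (jExt h' v))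
        = aExt h (u - I W) (I v)
          + ((1 - γ : ℝ) : ℂ) * inner ℂ (jExt h (I v)) (jExt h (u - I W)) - d W v := by
      have e1 := hu' v
      have e2 := hu (I v)
      rw [hj] at e2
      have e3 : aExt h' v v = aExt h' u' v - aExt h' W v := by
        rw [← sub_apply, ← map_sub]
      have e4 : inner ℂ (jExt h' v) (jExt h' v)
          = inner ℂ (jExt h' v) (jExt h' u') - inner ℂ (jExt h' v) (jExt h' W) := by
        rw [← inner_sub_right, ← map_sub, ← hv]
      have e5 : aExt h (u - I W) (I v) = aExt h u (I v) - aExt h (I W) (I v) := by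
        rw [map_sub, sub_apply]
      have e6 : inner ℂ (jExt h (I v)) (jExt h (u - I W))
          = inner ℂ (jExt h' v) (jExt h u) - inner ℂ (jExt h' v) (jExt h' W) := by
        rw [hj, map_sub (jExt h) u, inner_sub_right, hj]
      rw [e3, e4, e5, e6, hd]
      linear_combination e1 - e2
    rw [← h1, Complex.ofReal_re, norm_sq_formCompletion h' v, Complex.add_re,
      Complex.re_ofReal_mul, re_inner_self_eq]
  have hest : ‖v‖ ^ 2 ≤ M * α * ‖v‖ + ‖d W v‖ := by
    rw [Complex.ofReal_re] at hE
    rw [hE]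
    refine (Complex.re_le_norm _).trans ((norm_sub_le _ _).trans ?_)
    gcongr
    refine (norm_add_le _ _).trans ?_
    rw [norm_mul, Complex.norm_real, Real.norm_eq_abs, hM, add_mul, add_mul]
    refine add_le_add ((hC _ _).trans (by gcongr)) ?_
    rw [mul_assoc]
    gcongr
    refine (norm_inner_le_norm _ _).trans ?_
    rw [mul_comm]
    gcongr
    · exact norm_jExt_le h _
    · exact (norm_jExt_le h _).trans hIv
  have hfin : ‖v‖ ^ 2 ≤ 4 * M ^ 2 * α ^ 2 + 8 / Real.cos θ ^ 2 * (b w w - a w w).re := by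
    have e : 8 / Real.cos θ ^ 2 * (b w w - a w w).re
        = 4 * (2 / Real.cos θ ^ 2 * (b w w - a w w).re) := by ring
    rw [e]
    nlinarith [sq_nonneg (‖v‖ - 2 * (M * α))]
  calc ‖jExt h' u' - jExt h u‖ = ‖jExt h (I u' - u)‖ := by rw [map_sub, hj]
    _ ≤ ‖I u' - u‖ := norm_jExt_le h _
    _ = ‖I v - (u - I W)‖ := by congr 1; rw [hv, map_sub]; abel
    _ ≤ ‖I v‖ + α := norm_sub_le _ _
    _ ≤ _ := by
      gcongr
      exact hIv.trans (Real.le_sqrt_of_sq_le hfin)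

end FormConvergence

section FormSequences

variable {H : Type*} [NormedAddCommGroup H] [InnerProductSpace ℂ H] [CompleteSpace H]
  {E : Type*} [AddCommGroup E] [Module ℂ E] {a : SesqForm E} {j : E →ₗ[ℂ] H} {γ : ℝ}
  (ha : IsQuasiSectorial a j γ) {dom : ℕ → Submodule ℂ E} {an : ∀ n : ℕ, SesqForm (dom n)}
  {θ : ℝ} (hθ : θ ∈ Set.Ico 0 (Real.pi / 2))
  (hsect : ∀ (n : ℕ) (u : dom n), an n u u - a u u ∈ closure (sectorSet θ))

include ha hθ hsect

theorem tendsto_resolvent_formRel {D : Submodule ℂ E} (hD : IsFormCore ha D)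
    (hconv : ∀ u ∈ D, ∃ w : ∀ n : ℕ, dom n,
      Tendsto (fun n => FormDomain.of ha (w n : E)) atTop (𝓝 (FormDomain.of ha u)) ∧
      Tendsto (fun n => an n (w n) (w n) - a (w n) (w n)) atTop (𝓝 0)) (f : H) :
    Tendsto (fun n => (isMaxQuasiAccretive_formRel (ha.of_sub_mem hθ (hsect n))).resolvent 1
      le_rfl f) atTop (𝓝 ((isMaxQuasiAccretive_formRel ha).resolvent 1 le_rfl f)) := by
  obtain ⟨C, hC0, hC⟩ := exists_norm_aExt_le ha
  obtain ⟨u, hu⟩ := exists_forall_aExt_add_eq ha le_rfl f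
  set M := C + |1 - γ| with hM
  have hM0 : 0 ≤ M := by positivity
  rw [tendsto_iff_norm_sub_tendsto_zero, Metric.tendsto_nhds]
  intro ε hε
  -- an element `w` of the core with `(2 M + 1) ‖u - w‖ < ε`
  have hdense : Dense (formEmb ha '' (FormDomain.of ha '' (D : Set E))) :=
    (denseRange_formEmb ha).dense_image (formEmb ha).continuous hD
  obtain ⟨_, ⟨_, ⟨w, hw, rfl⟩, rfl⟩, hwu⟩ :=
    hdense.exists_dist_lt u (show 0 < ε / (2 * M + 1) by positivity)
  rw [dist_eq_norm, lt_div_iff₀ (by positivity)] at hwu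
  obtain ⟨wn, hwn, hδ⟩ := hconv w hw
  have hα : Tendsto (fun n => ‖u - formEmb ha (FormDomain.of ha (wn n : E))‖) atTop
      (𝓝 ‖u - formEmb ha (FormDomain.of ha w)‖) :=
    ((((formEmb ha).continuous.tendsto _).comp hwn).const_sub u).norm
  have hδ' : Tendsto (fun n => (an n (wn n) (wn n) - a (wn n) (wn n)).re) atTop (𝓝 0) :=
    (Complex.continuous_re.tendsto 0).comp hδ
  have hlim := (((hα.pow 2).const_mul (4 * M ^ 2)).add
    (hδ'.const_mul (8 / Real.cos θ ^ 2))).sqrt.add hα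
  have e : √(4 * M ^ 2 * ‖u - formEmb ha (FormDomain.of ha w)‖ ^ 2 + 8 / Real.cos θ ^ 2 * 0)
      + ‖u - formEmb ha (FormDomain.of ha w)‖
      = ‖u - formEmb ha (FormDomain.of ha w)‖ * (2 * M + 1) := by
    have : 4 * M ^ 2 * ‖u - formEmb ha (FormDomain.of ha w)‖ ^ 2 + 8 / Real.cos θ ^ 2 * 0
        = (2 * M * ‖u - formEmb ha (FormDomain.of ha w)‖) ^ 2 := by ring
    rw [this, Real.sqrt_sq (by positivity)]
    ring
  rw [e] at hlim
  filter_upwards [hlim.eventually (gt_mem_nhds hwu)] with n hn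
  rw [dist_zero_right, norm_norm]
  exact (norm_resolvent_formRel_sub_le ha hθ (hsect n) hC0 hC hu (wn n)).trans_lt hn

theorem relDomClosure_formRel_sub_le (n : ℕ) :
    relDomClosure (formRel (ha.of_sub_mem hθ (hsect n))) ≤ relDomClosure (formRel ha) := by
  refine relDomClosure_formRel_le _ (Submodule.isClosed_topologicalClosure _) fun x => ?_
  have := jExt_mem_relDomClosure ha (formEmb ha (FormDomain.of ha (x : E)))
  rwa [jExt_formEmb] at this

end FormSequences

end

theorem mainTheorem4
    {H : Type*} [NormedAddCommGroup H] [InnerProductSpace ℂ H] [CompleteSpace H]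
    {E : Type*} [AddCommGroup E] [Module ℂ E]
    (a : SesqForm E) (j : E →ₗ[ℂ] H) (γ : ℝ) (ha : IsQuasiSectorial a j γ)
    (dom : ℕ → Submodule ℂ E) (an : ∀ n : ℕ, SesqForm (dom n))
    (θ : ℝ) (hθ : θ ∈ Set.Ico 0 (Real.pi / 2))
    (hsect : ∀ (n : ℕ) (u : dom n), an n u u - a u u ∈ closure (sectorSet θ))
    (D : Submodule ℂ E) (hD : IsFormCore ha D)
    (hconv : ∀ u ∈ D, ∃ w : ∀ n : ℕ, dom n,
      Tendsto (fun n => FormDomain.of ha (w n : E)) atTop (𝓝 (FormDomain.of ha u)) ∧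
      Tendsto (fun n => an n (w n) (w n) - a (w n) (w n)) atTop (𝓝 0)) :
    (∃! T : ℝ≥0 → H →L[ℂ] H,
      IsDegenerateSemigroupGeneratedBy T (negRel (formRel ha))) ∧
    (∀ n : ℕ, ∃! S : ℝ≥0 → H →L[ℂ] H,
      IsDegenerateSemigroupGeneratedBy S (negRel (formRel (ha.of_sub_mem hθ (hsect n))))) ∧
    ∀ (T : ℝ≥0 → H →L[ℂ] H) (Tn : ℕ → ℝ≥0 → H →L[ℂ] H),
      IsDegenerateSemigroupGeneratedBy T (negRel (formRel ha)) →
      (∀ n : ℕ, IsDegenerateSemigroupGeneratedBy (Tn n)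
        (negRel (formRel (ha.of_sub_mem hθ (hsect n))))) →
      ∀ (x : H) (K : Set ℝ≥0), IsCompact K →
        TendstoUniformlyOn (fun n t => Tn n t x) (fun t => T t x) atTop K := by
  refine ⟨(isMaxQuasiAccretive_formRel ha).existsUnique_isDegenerateSemigroupGeneratedBy,
    fun n => (isMaxQuasiAccretive_formRel _).existsUnique_isDegenerateSemigroupGeneratedBy, ?_⟩
  intro T Tn hT hTn x K hK
  obtain ⟨b, hb⟩ := hK.bddAbove
  exact (tendstoUniformlyOn_of_tendsto_resolvent (isMaxQuasiAccretive_formRel ha)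
    (fun n => isMaxQuasiAccretive_formRel _) (relDomClosure_formRel_sub_le ha hθ hsect)
    (tendsto_resolvent_formRel ha hθ hsect hD hconv) hT hTn x b).mono fun t ht => hb ht
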